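/- Let $\rho:\mathbb R^3\to\mathbb R$ be a compactly supported, spherically symmetric function of class $H^2(\mathbb R^3)$. Write $\hat f(k)=(2\pi)^{-3/2}\int e^{ik\cdot x}f(x)\,dx$ and assume $\partial^\alpha\hat\rho(0)=0$ for all multi-indices $|\alpha|\le 4$. For $v\in\mathbb R^3$, $|v|<1$, let $\psi_v$ be the soliton field, the solution of $(-\Delta+(v\cdot\nabla)^2)\psi_v=-\rho$ given by $\hat\psi_v(k)=-\hat\rho(k)/(k^2-(k\cdot v)^2)$, and let $\pi_v=-v\cdot\nabla\psi_v$, $p_v=v/\sqrt{1-v^2}$. For $j=1,2,3$ put $$\tau_j=(-\partial_j\psi_v,\,-\partial_j\pi_v,\,e_j,\,0),\qquad \tau_{3+j}=(\partial_{v_j}\psi_v,\,\partial_{v_j}\pi_v,\,0,\,\partial_{v_j}p_v),$$ and let $$\Omega(Y_1,Y_2)=\int\psi_1\pi_2\,dx-\int\pi_1\psi_2\,dx+q_1\cdot p_2-p_1\cdot q_2,\qquad Y_i=(\psi_i,\pi_i,q_i,p_i).$$ Let $X_0=(\Psi_0,\Pi_0,Q_0,P_0)$ be real-valued with $Q_0,P_0\in\mathbb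 R^3$, $(1+|x|)^{\beta}\Psi_0,\ (1+|x|)^{\beta}\nabla\Psi_0,\ (1+|x|)^{\beta+1}\Pi_0\in L^2(\mathbb R^3)$, where $\beta=4+\delta$, $0<\delta<1/2$. Let $B_v=\sqrt{1-v^2}\,(I_3-v\otimes v)$ and, for $\operatorname{Re}\lambda>0$ and for $\lambda=0$, $$\Phi(\lambda)=i\int_{\mathbb R^3}\frac{k\,\big((ik\cdot v+\lambda)\hat\Psi_0(k)+\hat\Pi_0(k)\big)}{k^2+(ik\cdot v+\lambda)^2}\,\overline{\hat\rho(k)}\,dk\in\mathbb C^3 .$$ Then the integrals in $\Omega(X_0,\tau_j)$ and in $\Phi(\lambda)$ converge absolutely, the derivative $\Phi'(0)=\lim_{\lambda\to0,\,\operatorname{Re}\lambda>0}(\Phi(\lambda)-\Phi(0))/\lambda$ exists, and $$\Omega(X_0,\tau_j)=0\ \text{ for } j=1,\dots,6\quad\Longleftrightarrow\quad P_0+\Phi(0)=0\ \text{ and }\ B_v^{-1}Q_0+\Phi'(0)=0 .$$ -/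

import Mathlib

open MeasureTheory Complex
open scoped ComplexConjugate InnerProductSpace ContDiff Matrix

noncomputable section

namespace WaveParticle

/-- Physical (and momentum) space `ℝ³`. -/
abbrev E3 : Type := EuclideanSpace ℝ (Fin 3)

/-- The standard basis vector `e_j`. -/
def basisVec (j : Fin 3) : E3 := EuclideanSpace.single j 1

/-- The classical partial derivative `∂_j f (x)`. -/
def partialD {F : Type*} [NormedAddCommGroup F] [NormedSpace ℝ F]
    (j : Fin 3) (f : E3 → F) (x : E3) : F :=
  lineDeriv ℝ f x (basisVec j)

/-! ### Sobolev spaces -/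

/-- `g` is the weak partial derivative `∂_j f` on `ℝ³`. -/
def HasWeakPartial (j : Fin 3) (f g : E3 → ℝ) : Prop :=
  LocallyIntegrable f ∧ LocallyIntegrable g ∧
    ∀ φ : E3 → ℝ, ContDiff ℝ ∞ φ → HasCompactSupport φ →
      ∫ x, f x * partialD j φ x = -∫ x, g x * φ x

/-- The weighted space `L²_α`: `(1 + |x|)^α f ∈ L²`. -/
def MemWeightedL2 (α : ℝ) (f : E3 → ℝ) : Prop :=
  MemLp (fun x => (1 + ‖x‖) ^ α * f x) 2

/-- The weighted Sobolev space `H¹_α`: `f` and its weak gradient belong to `L²_α`. -/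
def MemWeightedH1 (α : ℝ) (f : E3 → ℝ) : Prop :=
  MemWeightedL2 α f ∧ ∀ j, ∃ g, HasWeakPartial j f g ∧ MemWeightedL2 α g

/-- The Sobolev space `H²`: `f` and its weak derivatives of orders one and two belong to `L²`. -/
def MemH2 (f : E3 → ℝ) : Prop :=
  MemLp f 2 ∧ ∀ j, ∃ g, HasWeakPartial j f g ∧ MemLp g 2 ∧
    ∀ l, ∃ h, HasWeakPartial l g h ∧ MemLp h 2

/-! ### The charge distribution -/

/-- The normalizing factor `(2π)^{-3/2}`. -/
def fourierConst : ℂ := (((2 * Real.pi) ^ (-(3 : ℝ) / 2) : ℝ) : ℂ)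

/-- The Fourier transform `f̂(k) = (2π)^{-3/2} ∫ e^{i k·x} f(x) dx`. -/
def fourierHat (f : E3 → ℝ) (k : E3) : ℂ :=
  fourierConst * ∫ x, cexp (I * (⟪k, x⟫_ℝ : ℂ)) * (f x : ℂ)

/-- The conditions on the charge distribution: it is of class `H²`, compactly supported and
spherically symmetric, and its Fourier transform vanishes at `0` together with all
derivatives of order at most four. -/
structure IsChargeDistribution (ρ : E3 → ℝ) : Prop where
  memH2 : MemH2 ρ
  compactSupport : ∃ R : ℝ, ∀ x, R ≤ ‖x‖ → ρ x = 0
  radial : ∃ ρ₁ : ℝ → ℝ, ∀ x, ρ x = ρ₁ ‖x‖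
  fourier_zero : ∀ n : ℕ, n ≤ 4 → iteratedFDeriv ℝ n (fourierHat ρ) 0 = 0

/-! ### Phase space and symplectic form -/

/-- A state `(ψ, π, q, p)`: the fields `ψ`, `π`, the position `q` and the momentum `p`. -/
structure State where
  psi : E3 → ℝ
  pi : E3 → ℝ
  q : E3
  p : E3

/-- The phase space `𝓔_α = H¹_α ⊕ L²_{α+1} ⊕ ℝ³ ⊕ ℝ³`. -/
def MemPhaseSpace (α : ℝ) (Y : State) : Prop :=
  MemWeightedH1 α Y.psi ∧ MemWeightedL2 (α + 1) Y.pi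

/-- The symplectic form
`Ω(Y₁, Y₂) = ⟨ψ₁, π₂⟩ - ⟨π₁, ψ₂⟩ + q₁·p₂ - p₁·q₂`. -/
def symplecticForm (Y₁ Y₂ : State) : ℝ :=
  (∫ x, Y₁.psi x * Y₂.pi x) - (∫ x, Y₁.pi x * Y₂.psi x) + ⟪Y₁.q, Y₂.p⟫_ℝ - ⟪Y₁.p, Y₂.q⟫_ℝ

/-- Both integrals in `Ω(Y₁, Y₂)` converge absolutely. -/
def SymplecticConverges (Y₁ Y₂ : State) : Prop :=
  Integrable (fun x => Y₁.psi x * Y₂.pi x) ∧ Integrable (fun x => Y₁.pi x * Y₂.psi x)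

/-! ### Solitons and tangent vectors -/

/-- The soliton field `ψ_v`, i.e. the solution of `(-Δ + (v·∇)²) ψ_v = -ρ` with
`ψ̂_v(k) = -ρ̂(k) / (k² - (k·v)²)`. The inverse transform is real since `ρ` is real. -/
def solitonPsi (ρ : E3 → ℝ) (v x : E3) : ℝ :=
  (fourierConst * ∫ k, cexp (-(I * (⟪k, x⟫_ℝ : ℂ))) *
    (-fourierHat ρ k / ((‖k‖ ^ 2 - ⟪k, v⟫_ℝ ^ 2 : ℝ) : ℂ))).re

/-- The soliton field `π_v = -v·∇ψ_v`. -/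
def solitonPi (ρ : E3 → ℝ) (v x : E3) : ℝ :=
  -lineDeriv ℝ (solitonPsi ρ v) x v

/-- The soliton momentum `p_v = v / √(1 - v²)`. -/
def solitonP (v : E3) : E3 := (Real.sqrt (1 - ‖v‖ ^ 2))⁻¹ • v

/-- The tangent vectors to the solitary manifold, in the moving frame:
`τ_j = (-∂_j ψ_v, -∂_j π_v, e_j, 0)` is indexed by `Sum.inl j`, and
`τ_{3+j} = (∂_{v_j} ψ_v, ∂_{v_j} π_v, 0, ∂_{v_j} p_v)` is indexed by `Sum.inr j`. -/
def tau (ρ : E3 → ℝ) (v : E3) : Fin 3 ⊕ Fin 3 → State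
  | Sum.inl j =>
    { psi := fun y => -partialD j (solitonPsi ρ v) y
      pi := fun y => -partialD j (solitonPi ρ v) y
      q := basisVec j
      p := 0 }
  | Sum.inr j =>
    { psi := fun y => partialD j (fun w => solitonPsi ρ w y) v
      pi := fun y => partialD j (fun w => solitonPi ρ w y) v
      q := 0
      p := partialD j solitonP v }

/-- The matrix `B_v = ν_v (I₃ - v ⊗ v)`, `ν_v = √(1 - v²)`. -/
def matB (v : E3) : Matrix (Fin 3) (Fin 3) ℝ :=
  Real.sqrt (1 - ‖v‖ ^ 2) • (1 - Matrix.of fun i j => v i * v j)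

/-! ### The functional `Φ` -/

/-- The symbol `D̂(λ) = k² + (i k·v + λ)²`. -/
def symbolD (v : E3) (z : ℂ) (k : E3) : ℂ :=
  ((‖k‖ ^ 2 : ℝ) : ℂ) + (I * (⟪k, v⟫_ℝ : ℂ) + z) ^ 2

/-- The integrand `k_j D̂(λ)⁻¹ ((i k·v + λ) Ψ̂₀ + Π̂₀) conj ρ̂` of `Φ_j(λ)`. -/
def phiIntegrand (ρ : E3 → ℝ) (v : E3) (psi0 pi0 : E3 → ℝ) (z : ℂ) (j : Fin 3) (k : E3) : ℂ :=
  (k j : ℂ) / symbolD v z k *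
    ((I * (⟪k, v⟫_ℝ : ℂ) + z) * fourierHat psi0 k + fourierHat pi0 k) * conj (fourierHat ρ k)

/-- `Φ(λ) = i ⟨((i k·v + λ) Ψ̂₀ + Π̂₀) / D̂(λ), k ρ̂⟩`, a vector in `ℂ³`. -/
def Phi (ρ : E3 → ℝ) (v : E3) (psi0 pi0 : E3 → ℝ) (z : ℂ) : Fin 3 → ℂ :=
  fun j => I * ∫ k, phiIntegrand ρ v psi0 pi0 z j k

/-- The open right half-plane, the domain of the Laplace transform, with the point `0` added. -/
def laplaceDomain : Set ℂ := insert 0 {z : ℂ | 0 < z.re}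

/-- The derivative `Φ'(0)`, where `λ → 0` within the right half-plane. -/
def PhiDerivZero (ρ : E3 → ℝ) (v : E3) (psi0 pi0 : E3 → ℝ) : Fin 3 → ℂ :=
  derivWithin (Phi ρ v psi0 pi0) laplaceDomain 0

end WaveParticle

end

/-! By Parseval each symplectic product becomes an integral over `k`. Put `s = ik·v + λ` and `D = k²
+ s²`; at `λ = 0` the soliton has `ψ̂_v = -ρ̂/D` and `π̂_v = -sρ̂/D`. The space derivative in `τ_j`
multiplies by `ik_j`, which reproduces minus the integrand of `Φ_j(0)`, while `e_j` contributes
`-P₀` (`symplecticForm_tau_inl`). Since `v` and `λ` enter only through `s`, the derivative `∂_{v_j}`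
acts as `ik_j ∂_λ`. So `τ_{3+j}` produces the integral of the `λ`-derivative at `0` of the integrand
of `Φ_j`, and `Q₀·∂_{v_j}p_v` is the `j`-th component of `B_v⁻¹Q₀` (`symplecticForm_tau_inr`).

What remains is that `Φ'(0)` exists and may be computed under the integral. For complex `λ` this
cannot be read off the integrand: near the imaginary axis `D` comes close to zero away from `k = 0`.
Along the positive real axis, however, `Re D ≥ k² - (k·v)²`, and `|ρ̂| ≤ C|k|` makes `ρ̂/|k|³`
integrable, so dominated convergence gives the one-sided real derivative (`tendsto_Phi_slope`).

Existence in the whole half-plane comes from the time domain. `Phi_eq_laplace` writes `Φ_j` as the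
Laplace transform of `phiTime`, the free wave evolution of the data tested against the charge moving
with velocity `v`. Once the evolution is shifted onto `ρ`, Huygens' principle leaves only data at
`|x| ≥ (1-|v|)t - R`, and the weights on the data turn this into decay `(1+t)^{-q}` with `q > 2`
(`exists_norm_phiTime_le`). Then `phiTime` and `t · phiTime` are integrable, so the Laplace
transform is differentiable at `0` within the closed half-plane (`hasDerivWithinAt_laplace`), and
the limit along the real axis identifies the derivative (`hasDerivWithinAt_Phi_apply`). -/

noncomputable section

namespace WaveParticle

/-! ### Plane waves and elementary properties of the Fourier transform -/

/-- The plane wave `e^{i k·x}`. -/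
def planeWave (k x : E3) : ℂ := cexp (I * (⟪k, x⟫_ℝ : ℂ))

@[fun_prop]
lemma Continuous.planeWave {X : Type*} [TopologicalSpace X] {f g : X → E3} (hf : Continuous f)
    (hg : Continuous g) : Continuous fun x => planeWave (f x) (g x) := by
  unfold WaveParticle.planeWave
  fun_prop

@[simp]
lemma norm_planeWave (k x : E3) : ‖planeWave k x‖ = 1 := by
  simp [planeWave, Complex.norm_exp]

lemma planeWave_neg_left (k x : E3) : planeWave (-k) x = conj (planeWave k x) := by
  simp [planeWave, ← Complex.exp_conj]

lemma planeWave_neg_right (k x : E3) : planeWave k (-x) = conj (planeWave k x) := by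
  simp [planeWave, ← Complex.exp_conj]

lemma planeWave_add_right (k x y : E3) :
    planeWave k (x + y) = planeWave k x * planeWave k y := by
  simp [planeWave, inner_add_right, mul_add, Complex.exp_add]

lemma norm_planeWave_sub_one_le (k x : E3) : ‖planeWave k x - 1‖ ≤ ‖k‖ * ‖x‖ :=
  (Real.norm_exp_I_mul_ofReal_sub_one_le (x := ⟪k, x⟫_ℝ)).trans (norm_inner_le_norm k x)

lemma integrable_planeWave_mul {f : E3 → ℂ} (hf : Integrable f) (k : E3) :
    Integrable fun x => planeWave k x * f x :=
  hf.bdd_mul (c := 1) (Continuous.aestronglyMeasurable (by fun_prop)) (by simp)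

lemma integrable_planeWave_mul_ofReal {f : E3 → ℝ} (hf : Integrable f) (k : E3) :
    Integrable fun x => planeWave k x * (f x : ℂ) :=
  integrable_planeWave_mul hf.ofReal k

lemma conj_fourierConst : conj fourierConst = fourierConst := by
  simp [fourierConst]

lemma fourierConst_ne_zero : fourierConst ≠ 0 := by
  rw [fourierConst, Complex.ofReal_ne_zero]
  positivity

lemma fourierHat_eq (f : E3 → ℝ) (k : E3) :
    fourierHat f k = fourierConst * ∫ x, planeWave k x * (f x : ℂ) := rfl

lemma fourierHat_neg (f : E3 → ℝ) (k : E3) : fourierHat f (-k) = conj (fourierHat f k) := by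
  simp only [fourierHat_eq, map_mul, conj_fourierConst, ← integral_conj, planeWave_neg_left,
    Complex.conj_ofReal]

lemma norm_fourierHat_le (f : E3 → ℝ) (k : E3) :
    ‖fourierHat f k‖ ≤ ‖fourierConst‖ * ∫ x, |f x| := by
  rw [fourierHat_eq, norm_mul]
  gcongr
  refine (norm_integral_le_integral_norm _).trans (le_of_eq ?_)
  simp

lemma continuous_fourierHat {f : E3 → ℝ} (hf : Integrable f) : Continuous (fourierHat f) := by
  refine continuous_const.mul (continuous_of_dominated (bound := fun x => |f x|) ?_ ?_ hf.abs ?_)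
  · exact fun k => (integrable_planeWave_mul_ofReal hf k).aestronglyMeasurable
  · exact fun k => Filter.Eventually.of_forall fun x => le_of_eq (by
      change ‖planeWave k x * (f x : ℂ)‖ = _
      simp)
  · exact Filter.Eventually.of_forall fun x => by fun_prop

lemma norm_fourierHat_sub_le {f : E3 → ℝ} (hf : Integrable f)
    (hxf : Integrable fun x => ‖x‖ * f x) (k : E3) :
    ‖fourierHat f k - fourierHat f 0‖ ≤ ‖fourierConst‖ * (∫ x, ‖x‖ * |f x|) * ‖k‖ := by
  rw [fourierHat_eq, fourierHat_eq, ← mul_sub, norm_mul, mul_assoc,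
    ← integral_sub (integrable_planeWave_mul_ofReal hf k)
      (integrable_planeWave_mul_ofReal hf 0)]
  gcongr
  rw [← integral_mul_const]
  refine norm_integral_le_of_norm_le ?_ (Filter.Eventually.of_forall fun x => ?_)
  · refine (hxf.abs.mul_const ‖k‖).congr (Filter.Eventually.of_forall fun x => ?_)
    simp [abs_mul]
  · have h0 : planeWave 0 x = 1 := by simp [planeWave]
    rw [h0, ← sub_mul, norm_mul, Complex.norm_real, Real.norm_eq_abs]
    calc _ ≤ ‖k‖ * ‖x‖ * |f x| := by gcongr; exact norm_planeWave_sub_one_le k x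
      _ = _ := by ring

lemma fourierHat_eq_fourier (f : E3 → ℝ) (k : E3) :
    fourierHat f k =
      fourierConst * FourierTransform.fourier (fun x => (f x : ℂ)) ((-(2 * Real.pi)⁻¹) • k) := by
  rw [fourierHat_eq, Real.fourier_eq']
  congr 2
  ext x
  rw [planeWave, smul_eq_mul, real_inner_smul_right, real_inner_comm]
  congr 2
  push_cast
  field_simp

/-! ### Plancherel for integrable, square integrable functions -/

/-- Both sides define the same tempered distribution: the `L²` transform is compatible with the
distributional one, and the Fourier integral satisfies the multiplication formula. This gives access
to Plancherel for the pointwise transform. -/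
lemma fourier_ae_eq_toLp {f : E3 → ℂ} (hf : Integrable f) (hf2 : MemLp f 2) :
    FourierTransform.fourier f =ᵐ[volume]
      (FourierTransform.fourier (hf2.toLp f) : Lp (α := E3) ℂ 2) := by
  have hcont : Continuous (FourierTransform.fourier f) :=
    VectorFourier.fourierIntegral_continuous Real.continuous_fourierChar
      continuous_inner hf
  refine ae_eq_of_integral_contDiff_smul_eq hcont.locallyIntegrable
    ((Lp.memLp _).locallyIntegrable one_le_two) fun g hg hgs => ?_
  have hg₁ : HasCompactSupport (Complex.ofRealCLM ∘ g) := hgs.comp_left rfl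
  have hg₂ : ContDiff ℝ ∞ (Complex.ofRealCLM ∘ g) := by fun_prop
  set φ : SchwartzMap E3 ℂ := hg₁.toSchwartzMap hg₂ with hφ
  have h1 := congrArg (fun T : TemperedDistribution E3 ℂ => T φ)
    (Lp.fourier_toTemperedDistribution_eq (hf2.toLp f))
  simp only [TemperedDistribution.fourier_apply] at h1
  rw [Lp.toTemperedDistribution_apply, Lp.toTemperedDistribution_apply] at h1
  have h2 : ∫ x, (FourierTransform.fourier φ) x • f x
      = ∫ x, φ x • FourierTransform.fourier f x := by
    rw [SchwartzMap.fourier_coe]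
    have := VectorFourier.integral_fourierIntegral_smul_eq_flip (L := innerₗ E3)
      Real.continuous_fourierChar continuous_inner (φ.integrable (μ := volume)) hf
    rw [flip_innerₗ] at this
    exact this
  have h3 : ∫ x, (FourierTransform.fourier φ) x • (hf2.toLp f) x
      = ∫ x, (FourierTransform.fourier φ) x • f x := by
    refine integral_congr_ae ?_
    filter_upwards [hf2.coeFn_toLp] with x hx
    rw [hx]
  have hφg : ∀ (F : E3 → ℂ) x, φ x • F x = g x • F x := fun F x => by
    simp [hφ]
  simp only [← hφg]
  rw [← h2, ← h3, h1]

lemma integrable_sq_norm_fourierHat {f : E3 → ℝ} (hf : Integrable f) (hf2 : MemLp f 2) :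
    Integrable fun k => ‖fourierHat f k‖ ^ 2 := by
  have h2 : MemLp (fun x => (f x : ℂ)) 2 := hf2.ofReal
  have h1 : Integrable (fun x => (f x : ℂ)) := hf.ofReal
  have h3 : MemLp (FourierTransform.fourier fun x => (f x : ℂ)) 2 :=
    (memLp_congr_ae (fourier_ae_eq_toLp h1 h2)).2 (Lp.memLp _)
  have h4 := (memLp_two_iff_integrable_sq_norm h3.1).1 h3
  have h5 := (h4.comp_smul (R := -(2 * Real.pi)⁻¹)
    (neg_ne_zero.2 (inv_ne_zero (by positivity)))).const_mul (‖fourierConst‖ ^ 2)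
  refine h5.congr (Filter.Eventually.of_forall fun k => ?_)
  simp only [fourierHat_eq_fourier, norm_mul, mul_pow]

/-! ### Weak derivatives and the Fourier transform -/

lemma partialD_eq_fderiv {F : Type*} [NormedAddCommGroup F] [NormedSpace ℝ F] {f : E3 → F}
    {x : E3} (hf : DifferentiableAt ℝ f x) (j : Fin 3) :
    partialD j f x = fderiv ℝ f x (basisVec j) :=
  hf.lineDeriv_eq_fderiv

lemma partialD_eq_of_hasDerivAt {F : Type*} [NormedAddCommGroup F] [NormedSpace ℝ F] {f : E3 → F}
    {x : E3} {j : Fin 3} {f' : F} (h : HasDerivAt (fun t : ℝ => f (x + t • basisVec j)) f' 0) :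
    partialD j f x = f' :=
  h.deriv

lemma continuous_partialD {F : Type*} [NormedAddCommGroup F] [NormedSpace ℝ F] {f : E3 → F}
    (hf : ContDiff ℝ ∞ f) (j : Fin 3) : Continuous (partialD j f) := by
  have : partialD j f = fun x => fderiv ℝ f x (basisVec j) := by
    ext x
    exact partialD_eq_fderiv (hf.differentiable (by simp)).differentiableAt j
  rw [this]
  exact (hf.continuous_fderiv (by simp)).clm_apply continuous_const

lemma exists_norm_partialD_le {F : Type*} [NormedAddCommGroup F] [NormedSpace ℝ F] {f : E3 → F}
    (hf : ContDiff ℝ ∞ f) (hs : HasCompactSupport f) (j : Fin 3) :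
    ∃ M, ∀ x, ‖partialD j f x‖ ≤ M := by
  have : partialD j f = fun x => fderiv ℝ f x (basisVec j) := by
    ext x
    exact partialD_eq_fderiv (hf.differentiable (by simp)).differentiableAt j
  have hs' : HasCompactSupport (partialD j f) := by
    rw [this]
    exact hs.fderiv_apply (𝕜 := ℝ) _
  exact hs'.exists_bound_of_continuous (continuous_partialD hf j)

lemma inner_basisVec (k : E3) (j : Fin 3) : ⟪k, basisVec j⟫_ℝ = k j := by
  simp [basisVec, EuclideanSpace.inner_single_right]

/-- `HasWeakPartial` tests against real functions only; plane waves need complex ones, obtained by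
splitting into real and imaginary parts. -/
lemma HasWeakPartial.integral_mul_partialD {j : Fin 3} {f g : E3 → ℝ} (h : HasWeakPartial j f g)
    (hf : Integrable f) (hg : Integrable g) {φ : E3 → ℂ} (hφ : ContDiff ℝ ∞ φ)
    (hs : HasCompactSupport φ) :
    ∫ x, (f x : ℂ) * partialD j φ x = -∫ x, (g x : ℂ) * φ x := by
  obtain ⟨M, hM⟩ := exists_norm_partialD_le hφ hs j
  obtain ⟨N, hN⟩ := hs.exists_bound_of_continuous hφ.continuous
  have hi1 : Integrable fun x => (f x : ℂ) * partialD j φ x :=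
    (hf.ofReal (𝕜 := ℂ)).mul_bdd (c := M) (continuous_partialD hφ j).aestronglyMeasurable
      (Filter.Eventually.of_forall hM)
  have hi2 : Integrable fun x => (g x : ℂ) * φ x :=
    (hg.ofReal (𝕜 := ℂ)).mul_bdd (c := N) hφ.continuous.aestronglyMeasurable
      (Filter.Eventually.of_forall hN)
  have hd : ∀ x, DifferentiableAt ℝ φ x := fun x => (hφ.differentiable (by simp)).differentiableAt
  have key : ∀ L : ℂ →L[ℝ] ℝ, (∀ (r : ℝ) (w : ℂ), L (r * w) = r * L w) →
      L (∫ x, (f x : ℂ) * partialD j φ x) = L (-∫ x, (g x : ℂ) * φ x) := by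
    intro L hL
    have hw := h.2.2 (L ∘ φ) (L.contDiff.comp hφ) (hs.comp_left (map_zero L))
    have hp : ∀ x, partialD j (L ∘ φ) x = L (partialD j φ x) := by
      intro x
      rw [partialD_eq_fderiv (L.differentiableAt.comp x (hd x)), partialD_eq_fderiv (hd x),
        fderiv_comp x L.differentiableAt (hd x)]
      simp
    rw [map_neg, ← L.integral_comp_comm hi1, ← L.integral_comp_comm hi2]
    simpa only [hL, hp, Function.comp_apply] using hw
  apply Complex.ext
  · exact key Complex.reCLM (by simp)
  · exact key Complex.imCLM (by simp)

lemma hasDerivAt_planeWave_right (k x w : E3) (t : ℝ) :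
    HasDerivAt (fun t : ℝ => planeWave k (x + t • w))
      (I * (⟪k, w⟫_ℝ : ℂ) * planeWave k (x + t • w)) t := by
  unfold planeWave
  have h : HasDerivAt (fun t : ℝ => I * ((⟪k, x + t • w⟫_ℝ : ℝ) : ℂ)) (I * (⟪k, w⟫_ℝ : ℂ)) t := by
    simp only [inner_add_right, real_inner_smul_right]
    refine HasDerivAt.const_mul I (HasDerivAt.ofReal_comp ?_)
    simpa using ((hasDerivAt_id t).mul_const ⟪k, w⟫_ℝ).const_add ⟪k, x⟫_ℝ
  convert h.cexp using 1
  ring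

lemma contDiff_planeWave (k : E3) : ContDiff ℝ ∞ (planeWave k) := by
  unfold planeWave
  have h : ContDiff ℝ ∞ fun x : E3 => (⟪k, x⟫_ℝ : ℂ) :=
    Complex.ofRealCLM.contDiff.comp (contDiff_const.inner ℝ contDiff_id)
  exact (contDiff_const.mul h).cexp

/-- The plane wave is not compactly supported, so it is multiplied by the cutoffs `χ(a n • x)` with
`a n → 0`. The derivative falling on the cutoff carries a factor `a n` and disappears in the limit
by dominated convergence. -/
lemma HasWeakPartial.fourierHat_eq {j : Fin 3} {f g : E3 → ℝ} (h : HasWeakPartial j f g)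
    (hf : Integrable f) (hg : Integrable g) (k : E3) :
    fourierHat g k = -(I * (k j : ℂ)) * fourierHat f k := by
  let χ : ContDiffBump (0 : E3) := ⟨1, 2, one_pos, one_lt_two⟩
  let a : ℕ → ℝ := fun n => ((n : ℝ) + 1)⁻¹
  have ha0 : ∀ n, 0 < a n := fun n => by positivity
  have ha1 : ∀ n, a n ≤ 1 := fun n => inv_le_one_of_one_le₀ (by simp)
  have ha : Filter.Tendsto a Filter.atTop (nhds 0) := by
    simpa [a] using tendsto_one_div_add_atTop_nhds_zero_nat (𝕜 := ℝ)
  have hax : ∀ x : E3, Filter.Tendsto (fun n => a n • x) Filter.atTop (nhds 0) := fun x => by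
    simpa using ha.smul_const x
  have hχc : ContDiff ℝ ∞ χ := χ.contDiff
  obtain ⟨M, hM⟩ := exists_norm_partialD_le hχc χ.hasCompactSupport j
  let φ : ℕ → E3 → ℂ := fun n x => (χ (a n • x) : ℂ) * planeWave k x
  have hχn : ∀ n, ContDiff ℝ ∞ fun x : E3 => ((χ (a n • x) : ℝ) : ℂ) := fun n =>
    Complex.ofRealCLM.contDiff.comp (hχc.comp (contDiff_const_smul (a n)))
  have hφc : ∀ n, ContDiff ℝ ∞ (φ n) := fun n => (hχn n).mul (contDiff_planeWave k)
  have hφs : ∀ n, HasCompactSupport (φ n) := fun n => by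
    refine HasCompactSupport.mul_right ?_
    have h1 : HasCompactSupport fun x : E3 => χ (a n • x) :=
      χ.hasCompactSupport.comp_homeomorph (Homeomorph.smulOfNeZero (a n) (ha0 n).ne')
    exact h1.comp_left (g := ((↑) : ℝ → ℂ)) (by simp)
  have hφd : ∀ n x, partialD j (φ n) x = ((a n * partialD j χ (a n • x) : ℝ) : ℂ) * planeWave k x
      + (χ (a n • x) : ℂ) * (I * (k j : ℂ) * planeWave k x) := by
    intro n x
    apply partialD_eq_of_hasDerivAt
    have h1 := hasDerivAt_planeWave_right k x (basisVec j) 0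
    have h2 : HasDerivAt (fun t : ℝ => χ (a n • (x + t • basisVec j)))
        (a n * partialD j χ (a n • x)) 0 := by
      have hd : DifferentiableAt ℝ χ (a n • x) :=
        (hχc.differentiable (by simp)).differentiableAt
      rw [partialD_eq_fderiv hd, ← smul_eq_mul, ← map_smul]
      have h3 : HasDerivAt (fun t : ℝ => a n • (x + t • basisVec j)) (a n • basisVec j) 0 := by
        simpa using (((hasDerivAt_id (0 : ℝ)).smul_const (basisVec j)).const_add x).fun_const_smul
          (a n)
      have h4 : HasFDerivAt χ (fderiv ℝ χ (a n • x)) (a n • (x + (0 : ℝ) • basisVec j)) := by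
        simpa using hd.hasFDerivAt
      exact HasFDerivAt.comp_hasDerivAt (l := χ) (f := fun t : ℝ => a n • (x + t • basisVec j))
        (0 : ℝ) h4 h3
    have h5 := h2.ofReal_comp.fun_mul h1
    simpa [φ, inner_basisVec] using h5
  have hw : ∀ n, ∫ x, (f x : ℂ) * partialD j (φ n) x = -∫ x, (g x : ℂ) * φ n x := fun n =>
    h.integral_mul_partialD hf hg (hφc n) (hφs n)
  have hχ1 : ∀ x : E3, Filter.Tendsto (fun n => ((χ (a n • x) : ℝ) : ℂ)) Filter.atTop (nhds 1) := by
    intro x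
    have h1 : χ (0 : E3) = 1 := χ.one_of_mem_closedBall (by simp [χ])
    have h2 := ((χ.continuous.tendsto 0).comp (hax x))
    rw [h1] at h2
    exact_mod_cast (Complex.continuous_ofReal.tendsto 1).comp h2
  have hL : Filter.Tendsto (fun n => ∫ x, (f x : ℂ) * partialD j (φ n) x) Filter.atTop
      (nhds (∫ x, (f x : ℂ) * (I * (k j : ℂ) * planeWave k x))) := by
    refine tendsto_integral_of_dominated_convergence (fun x => |f x| * (M + |k j|)) ?_ ?_ ?_ ?_
    · exact fun n => (hf.ofReal (𝕜 := ℂ)).aestronglyMeasurable.mul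
        (continuous_partialD (hφc n) j).aestronglyMeasurable
    · exact hf.abs.mul_const _
    · refine fun n => Filter.Eventually.of_forall fun x => ?_
      rw [norm_mul, Complex.norm_real, Real.norm_eq_abs, hφd]
      gcongr
      refine (norm_add_le _ _).trans (add_le_add ?_ ?_)
      · simp only [norm_mul, norm_planeWave, mul_one, Complex.norm_real, Real.norm_eq_abs]
        rw [abs_of_pos (ha0 n)]
        exact (mul_le_of_le_one_left (abs_nonneg _) (ha1 n)).trans (hM _)
      · simp only [norm_mul, norm_planeWave, mul_one, Complex.norm_real, Real.norm_eq_abs,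
          Complex.norm_I, one_mul]
        rw [abs_of_nonneg χ.nonneg]
        exact mul_le_of_le_one_left (abs_nonneg _) χ.le_one
    · refine Filter.Eventually.of_forall fun x => Filter.Tendsto.const_mul _ ?_
      simp only [hφd]
      have h1 : Filter.Tendsto (fun n => a n * partialD j χ (a n • x)) Filter.atTop (nhds 0) := by
        simpa using ha.mul
          (((continuous_partialD hχc j).tendsto 0).comp (hax x))
      have h2 := ((Complex.continuous_ofReal.tendsto 0).comp h1).mul_const (planeWave k x)
      have h3 := h2.add ((hχ1 x).mul_const (I * (k j : ℂ) * planeWave k x))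
      simpa using h3
  have hR : Filter.Tendsto (fun n => -∫ x, (g x : ℂ) * φ n x) Filter.atTop
      (nhds (-∫ x, (g x : ℂ) * planeWave k x)) := by
    refine Filter.Tendsto.neg (tendsto_integral_of_dominated_convergence (fun x => |g x|)
      ?_ hg.abs ?_ ?_)
    · exact fun n => (hg.ofReal (𝕜 := ℂ)).aestronglyMeasurable.mul
        (hφc n).continuous.aestronglyMeasurable
    · refine fun n => Filter.Eventually.of_forall fun x => ?_
      simp only [φ, norm_mul, norm_planeWave, mul_one, Complex.norm_real, Real.norm_eq_abs]
      rw [abs_of_nonneg χ.nonneg]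
      exact mul_le_of_le_one_right (abs_nonneg _) χ.le_one
    · refine Filter.Eventually.of_forall fun x => Filter.Tendsto.const_mul _ ?_
      simpa [φ] using (hχ1 x).mul_const (planeWave k x)
  have hfin := tendsto_nhds_unique (hL.congr hw) hR
  have e1 : ∫ x, (f x : ℂ) * (I * (k j : ℂ) * planeWave k x)
      = I * (k j : ℂ) * ∫ x, planeWave k x * (f x : ℂ) := by
    rw [← integral_const_mul]
    congr 1; ext x; ring
  have e2 : ∫ x, (g x : ℂ) * planeWave k x = ∫ x, planeWave k x * (g x : ℂ) := by
    congr 1; ext x; ring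
  rw [e1, e2] at hfin
  rw [WaveParticle.fourierHat_eq, WaveParticle.fourierHat_eq]
  linear_combination fourierConst * hfin

/-! ### Weighted spaces -/

lemma finrank_E3 : Module.finrank ℝ E3 = 3 := by simp

lemma memLp_one_add_norm_rpow {r : ℝ} (hr : 3 / 2 < r) :
    MemLp (fun x : E3 => (1 + ‖x‖) ^ (-r)) 2 := by
  have hc : Continuous fun x : E3 => (1 + ‖x‖) ^ (-r) :=
    (by fun_prop : Continuous fun x : E3 => 1 + ‖x‖).rpow_const
      fun x => Or.inl (by positivity)
  refine (memLp_two_iff_integrable_sq hc.aestronglyMeasurable).2 ?_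
  refine (integrable_one_add_norm (E := E3) (μ := volume) (r := 2 * r) ?_).congr
    (Filter.Eventually.of_forall fun x => ?_)
  · rw [finrank_E3]; push_cast; linarith
  · simp only
    rw [← Real.rpow_natCast, ← Real.rpow_mul (by positivity)]
    congr 1; push_cast; ring

/-- Cauchy–Schwarz against `(1+|x|)^{-(α-q)}`, which is square integrable on `ℝ³` when `α - q >
3/2`. -/
lemma MemWeightedL2.integrable_rpow_mul {α q : ℝ} {f : E3 → ℝ} (hf : MemWeightedL2 α f)
    (hq : q + 3 / 2 < α) : Integrable fun x => (1 + ‖x‖) ^ q * f x := by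
  refine (MemLp.integrable_mul (p := 2) (q := 2) (memLp_one_add_norm_rpow
    (r := α - q) (by linarith)) hf).congr (Filter.Eventually.of_forall fun x => ?_)
  simp only [Pi.mul_apply]
  rw [← mul_assoc, ← Real.rpow_add (by positivity)]
  congr 2; ring

lemma MemWeightedL2.integrable {α : ℝ} {f : E3 → ℝ} (hf : MemWeightedL2 α f)
    (hα : 3 / 2 < α) : Integrable f := by
  simpa using hf.integrable_rpow_mul (q := 0) (by linarith)

/-! ### The Fourier transform of the charge distribution -/

lemma integrable_of_ae_eq_zero_of_lt_norm {f : E3 → ℝ} (hf : MemLp f 2) {R : ℝ}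
    (h0 : ∀ᵐ x : E3, R < ‖x‖ → f x = 0) : Integrable f := by
  have h1 : IntegrableOn f (Metric.closedBall 0 R) :=
    haveI : IsFiniteMeasure (volume.restrict (Metric.closedBall (0 : E3) R)) :=
      ⟨by rw [Measure.restrict_apply_univ]; exact measure_closedBall_lt_top⟩
    (hf.restrict _).integrable one_le_two
  refine ((integrable_indicator_iff measurableSet_closedBall).2 h1).congr ?_
  filter_upwards [h0] with x hx
  by_cases hxR : x ∈ Metric.closedBall (0 : E3) R
  · simp [hxR]
  · rw [Set.indicator_of_notMem hxR, hx (by simpa using hxR)]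

lemma HasWeakPartial.ae_eq_zero_of_lt_norm {j : Fin 3} {f g : E3 → ℝ} (h : HasWeakPartial j f g)
    {R : ℝ} (h0 : ∀ᵐ x : E3, R < ‖x‖ → f x = 0) : ∀ᵐ x : E3, R < ‖x‖ → g x = 0 := by
  have hU : IsOpen {x : E3 | R < ‖x‖} := isOpen_lt continuous_const continuous_norm
  refine hU.ae_eq_zero_of_integral_contDiff_smul_eq_zero (h.2.1.locallyIntegrableOn _)
    fun φ hφ hs hsub => ?_
  have h1 := h.2.2 φ hφ hs
  have h2 : ∫ x, f x * partialD j φ x = 0 := by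
    refine integral_eq_zero_of_ae ?_
    filter_upwards [h0] with x hx
    by_cases hxs : x ∈ tsupport φ
    · simp [hx (hsub hxs)]
    · rw [partialD_eq_fderiv (hφ.differentiable (by simp)).differentiableAt,
        fderiv_of_notMem_tsupport (𝕜 := ℝ) hxs]
      simp
  rw [h2] at h1
  simp only [smul_eq_mul, mul_comm (φ _)]
  linarith

namespace IsChargeDistribution

variable {ρ : E3 → ℝ} (hρ : IsChargeDistribution ρ)
include hρ

lemma exists_radius : ∃ R : ℝ, 0 ≤ R ∧ ∀ x, R < ‖x‖ → ρ x = 0 := by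
  obtain ⟨R, hR⟩ := hρ.compactSupport
  exact ⟨max R 0, le_max_right _ _, fun x hx => hR x ((le_max_left _ _).trans hx.le)⟩

lemma integrable : Integrable ρ := by
  obtain ⟨R, -, hR⟩ := hρ.exists_radius
  exact integrable_of_ae_eq_zero_of_lt_norm hρ.memH2.1 (Filter.Eventually.of_forall hR)

lemma integrable_norm_mul : Integrable fun x => ‖x‖ * ρ x := by
  obtain ⟨R, -, hR⟩ := hρ.exists_radius
  refine (hρ.integrable.norm.const_mul R).mono'
    (continuous_norm.aestronglyMeasurable.mul hρ.integrable.aestronglyMeasurable)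
    (Filter.Eventually.of_forall fun x => ?_)
  rw [norm_mul, norm_norm]
  by_cases hx : R < ‖x‖
  · simp [hR x hx]
  · gcongr; exact not_lt.1 hx

lemma continuous_fourierHat : Continuous (fourierHat ρ) :=
  WaveParticle.continuous_fourierHat hρ.integrable

/-- Encodes `k_j² ρ̂ ∈ L²` through the pure second derivative `∂_j²ρ`, which inherits integrability
from the compact support of `ρ`. -/
lemma exists_sq_mul_fourierHat_eq (j : Fin 3) :
    ∃ h : E3 → ℝ, Integrable h ∧ MemLp h 2 ∧
      ∀ k : E3, fourierHat h k = -((k j : ℂ) ^ 2) * fourierHat ρ k := by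
  obtain ⟨R, -, hR⟩ := hρ.exists_radius
  obtain ⟨g, hg, hg2, hgd⟩ := hρ.memH2.2 j
  obtain ⟨h, hh, hh2⟩ := hgd j
  have hg0 := hg.ae_eq_zero_of_lt_norm (Filter.Eventually.of_forall hR)
  have hgi := integrable_of_ae_eq_zero_of_lt_norm hg2 hg0
  have hhi := integrable_of_ae_eq_zero_of_lt_norm hh2 (hh.ae_eq_zero_of_lt_norm hg0)
  refine ⟨h, hhi, hh2, fun k => ?_⟩
  rw [hh.fourierHat_eq hgi hhi, hg.fourierHat_eq hρ.integrable hgi]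
  linear_combination (k j : ℂ) ^ 2 * fourierHat ρ k * I_sq

/-- `ρ̂` is the product of `(1+k²)⁻¹` and `(1+k²)ρ̂`; the first is square integrable in dimension
three, the second because `ρ ∈ H²`. -/
lemma integrable_fourierHat : Integrable (fourierHat ρ) := by
  choose h hi h2 hh using hρ.exists_sq_mul_fourierHat_eq
  have hw : Integrable fun k : E3 => ((1 : ℝ) + ‖k‖ ^ 2) ^ (-(4 : ℝ) / 2) :=
    integrable_rpow_neg_one_add_norm_sq (by rw [finrank_E3]; norm_num)
  have hA := integrable_sq_norm_fourierHat hρ.integrable hρ.memH2.1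
  have hB := fun j => integrable_sq_norm_fourierHat (hi j) (h2 j)
  refine ((hw.add (hA.add (((hB 0).add (hB 1)).add (hB 2)))).const_mul 2).mono'
    hρ.continuous_fourierHat.aestronglyMeasurable (Filter.Eventually.of_forall fun k => ?_)
  have hn : ‖k‖ ^ 2 = k 0 ^ 2 + k 1 ^ 2 + k 2 ^ 2 := by
    rw [EuclideanSpace.real_norm_sq_eq, Fin.sum_univ_three]
  have hb : ∀ j, ‖fourierHat (h j) k‖ = k j ^ 2 * ‖fourierHat ρ k‖ := fun j => by
    rw [hh, norm_mul, norm_neg, norm_pow, Complex.norm_real, Real.norm_eq_abs, sq_abs]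
  simp only [Pi.add_apply]
  have hr : ((1 : ℝ) + ‖k‖ ^ 2) ^ (-(4 : ℝ) / 2) = ((1 + ‖k‖ ^ 2)⁻¹) ^ 2 := by
    rw [show (-(4 : ℝ) / 2) = -((2 : ℕ) : ℝ) by norm_num, Real.rpow_neg (by positivity),
      Real.rpow_natCast, inv_pow]
  rw [hr]
  have h0 : ‖fourierHat ρ k‖ = (1 + ‖k‖ ^ 2)⁻¹ * (‖fourierHat ρ k‖ + (‖fourierHat (h 0) k‖
      + ‖fourierHat (h 1) k‖ + ‖fourierHat (h 2) k‖)) := by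
    rw [hb, hb, hb, eq_inv_mul_iff_mul_eq₀ (by positivity), hn]
    ring
  set w := (1 + ‖k‖ ^ 2)⁻¹
  set a := ‖fourierHat ρ k‖
  set b := ‖fourierHat (h 0) k‖
  set c := ‖fourierHat (h 1) k‖
  set d := ‖fourierHat (h 2) k‖
  rw [h0]
  -- Young's inequality applied to each of `wa`, `wb`, `wc`, `wd`; the four copies of `w²/2` explain
  -- the factor `2` in the majorant.
  nlinarith [sq_nonneg (w - a), sq_nonneg (w - b), sq_nonneg (w - c), sq_nonneg (w - d),
    sq_nonneg a, sq_nonneg b, sq_nonneg c, sq_nonneg d, sq_nonneg w]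

lemma fourierHat_zero : fourierHat ρ 0 = 0 := by
  have h := hρ.fourier_zero 0 (by norm_num)
  have := congrArg (fun L => L (fun _ => (0 : E3))) h
  simpa using this

lemma exists_norm_fourierHat_le : ∃ C, 0 ≤ C ∧ ∀ k, ‖fourierHat ρ k‖ ≤ C * ‖k‖ := by
  refine ⟨‖fourierConst‖ * ∫ x, ‖x‖ * |ρ x|, by positivity, fun k => ?_⟩
  simpa [hρ.fourierHat_zero] using norm_fourierHat_sub_le hρ.integrable hρ.integrable_norm_mul k

/-- In the unit ball `|ρ̂| ≤ C|k|` bounds the quotient by `C|k|⁻²`, integrable in dimension three;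
outside it the quotient is at most `|ρ̂|`. -/
lemma integrable_norm_fourierHat_div_pow {n : ℕ} (hn : n ≤ 3) :
    Integrable fun k => ‖fourierHat ρ k‖ / ‖k‖ ^ n := by
  obtain ⟨C, hC0, hC⟩ := hρ.exists_norm_fourierHat_le
  have h1 : IntegrableOn (fun k : E3 => (‖k‖ ^ 2)⁻¹) (Metric.ball 0 1) := by
    refine (integrableOn_fun_norm_addHaar (E := E3) (μ := volume)
      (f := fun y : ℝ => (y ^ 2)⁻¹)).2 ?_
    refine (integrableOn_const (C := (1 : ℝ)) (μ := volume) (s := Set.Ioo (0 : ℝ) 1)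
      (by simp)).congr_fun
      (fun y hy => ?_) measurableSet_Ioo
    have : y ≠ 0 := hy.1.ne'
    simp [this]
  have h2 := ((integrable_indicator_iff Metric.isOpen_ball.measurableSet).2 h1).const_mul C
  refine (h2.add hρ.integrable_fourierHat.norm).mono' ?_ (Filter.Eventually.of_forall fun k => ?_)
  · exact (hρ.continuous_fourierHat.norm.measurable.div
      (continuous_norm.pow n).measurable).aestronglyMeasurable
  · rw [norm_div, norm_norm, norm_pow, norm_norm, Pi.add_apply]
    by_cases hk : k ∈ Metric.ball (0 : E3) 1
    · rw [Set.indicator_of_mem hk]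
      have hk1 : ‖k‖ < 1 := by simpa using hk
      refine le_add_of_le_of_nonneg ?_ (norm_nonneg _)
      rcases eq_or_ne k 0 with rfl | hk0
      · simp [hρ.fourierHat_zero]
      have hkp : 0 < ‖k‖ := norm_pos_iff.2 hk0
      rw [← div_eq_mul_inv, div_le_div_iff₀ (by positivity) (by positivity)]
      have h3 : ‖k‖ ^ 3 ≤ ‖k‖ ^ n := pow_le_pow_of_le_one hkp.le hk1.le hn
      calc _ ≤ C * ‖k‖ * ‖k‖ ^ 2 := by gcongr; exact hC k
        _ = C * ‖k‖ ^ 3 := by ring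
        _ ≤ _ := by gcongr
    · rw [Set.indicator_of_notMem hk, mul_zero, zero_add]
      have hk1 : 1 ≤ ‖k‖ := by simpa using hk
      exact div_le_self (norm_nonneg _) (one_le_pow₀ hk1)

/-- Fourier inversion: as `ρ` is real, this integral is a multiple of `ρ(x)`. It puts the support of
`ρ` in the form used by Huygens' principle. -/
lemma exists_radius_integral_eq_zero : ∃ R : ℝ, 0 ≤ R ∧
    ∀ x, R < ‖x‖ → ∫ k, planeWave k x * conj (fourierHat ρ k) = 0 := by
  obtain ⟨R, hR0, hR⟩ := hρ.exists_radius
  refine ⟨R, hR0, fun x hx => ?_⟩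
  have hU : IsOpen {x : E3 | R < ‖x‖} := isOpen_lt continuous_const continuous_norm
  -- Pointwise inversion needs continuity at `x`. It holds here because `ρ` vanishes on a
  -- neighbourhood of `x`.
  have hcont : ContinuousAt (fun x => (ρ x : ℂ)) x := by
    have : (fun x => (ρ x : ℂ)) =ᶠ[nhds x] fun _ => 0 := by
      filter_upwards [hU.mem_nhds hx] with y hy
      simp [hR y hy]
    exact continuousAt_const.congr this.symm
  have hpi : (0 : ℝ) < 2 * Real.pi := by positivity
  have hF : ∀ w : E3, FourierTransform.fourier (fun x => (ρ x : ℂ)) w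
      = fourierConst⁻¹ * conj (fourierHat ρ ((2 * Real.pi) • w)) := by
    intro w
    rw [← fourierHat_neg, fourierHat_eq_fourier, inv_mul_cancel_left₀ fourierConst_ne_zero]
    rw [← smul_neg, smul_smul, neg_mul, inv_mul_cancel₀ hpi.ne']
    simp
  have hFi : Integrable (FourierTransform.fourier fun x => (ρ x : ℂ)) := by
    rw [funext hF]
    refine Integrable.const_mul ?_ _
    exact ((Complex.conjCLE.toContinuousLinearMap.integrable_comp
      hρ.integrable_fourierHat).comp_smul hpi.ne')
  have hinv := hρ.integrable.ofReal.fourierInv_fourier_eq (v := x) hFi hcont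
  rw [Real.fourierInv_eq'] at hinv
  have h1 : ∀ w : E3, cexp (((2 * Real.pi * ⟪w, x⟫_ℝ : ℝ) : ℂ) * I) •
      FourierTransform.fourier (fun x => (ρ x : ℂ)) w = fourierConst⁻¹ *
        (fun k => planeWave k x * conj (fourierHat ρ k)) ((2 * Real.pi) • w) := by
    intro w
    simp only [hF, planeWave, real_inner_smul_left, smul_eq_mul, mul_comm I]
    ring
  have h2 : (∫ w : E3, fourierConst⁻¹ *
        (fun k => planeWave k x * conj (fourierHat ρ k)) ((2 * Real.pi) • w)) = 0 := by
    rw [← funext h1]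
    refine hinv.trans ?_
    simp [hR x hx]
  rw [integral_const_mul, Measure.integral_comp_smul volume
    (fun k => planeWave k x * conj (fourierHat ρ k))] at h2
  have h3 := (mul_eq_zero.1 h2).resolve_left (inv_ne_zero fourierConst_ne_zero)
  refine (smul_eq_zero.1 h3).resolve_left ?_
  positivity

end IsChargeDistribution

/-! ### The Fourier transform of a ball and Huygens' principle -/

/-- The Fourier transform of the indicator function of the ball of radius `t`, at a wave vector
of length `κ`. -/
def ballTransform (κ t : ℝ) : ℝ :=
  4 * Real.pi * (Real.sin (κ * t) - κ * t * Real.cos (κ * t)) / κ ^ 3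

lemma hasDerivAt_ballTransform (κ t : ℝ) :
    HasDerivAt (ballTransform κ) (4 * Real.pi * t * (Real.sin (κ * t) / κ)) t := by
  rcases eq_or_ne κ 0 with rfl | hκ
  · have : ballTransform 0 = fun _ => 0 := by ext; simp [ballTransform]
    rw [this]
    simpa using hasDerivAt_const t (0 : ℝ)
  have h1 : HasDerivAt (fun t : ℝ => κ * t) κ t := by
    simpa using (hasDerivAt_id t).const_mul κ
  have h2 := ((h1.sin.fun_sub (h1.fun_mul h1.cos)).const_mul (4 * Real.pi)).div_const (κ ^ 3)
  refine h2.congr_deriv ?_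
  field_simp
  ring

/-- The weight `π(t² - s²)` is the area of the slice of the ball at height `s`; an explicit
antiderivative, found by integrating by parts twice, evaluates the integral. -/
lemma integral_cexp_mul_sq_sub_sq {κ : ℝ} (hκ : κ ≠ 0) (t : ℝ) :
    ∫ s in (-t)..t, cexp (I * ((κ * s : ℝ) : ℂ)) * ((Real.pi * (t ^ 2 - s ^ 2) : ℝ) : ℂ) =
      (ballTransform κ t : ℂ) := by
  have hκ' : (κ : ℂ) ≠ 0 := Complex.ofReal_ne_zero.2 hκ
  have hd : ∀ s : ℝ, HasDerivAt (fun s : ℝ => Real.pi * (cexp (I * ((κ * s : ℝ) : ℂ)) *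
      (-I * (t ^ 2 - s ^ 2) / κ - 2 * s / κ ^ 2 - 2 * I / κ ^ 3)))
      (cexp (I * ((κ * s : ℝ) : ℂ)) * ((Real.pi * (t ^ 2 - s ^ 2) : ℝ) : ℂ)) s := by
    intro s
    have hs : HasDerivAt (fun s : ℝ => (s : ℂ)) 1 s := (hasDerivAt_id s).ofReal_comp
    have h1 : HasDerivAt (fun s : ℝ => I * ((κ * s : ℝ) : ℂ)) (I * κ) s := by
      simpa using (hs.const_mul (κ : ℂ)).const_mul I
    have h2 := ((((hs.fun_pow 2).const_sub ((t : ℂ) ^ 2)).const_mul (-I)).div_const (κ : ℂ)).fun_sub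
      ((hs.const_mul 2).div_const ((κ : ℂ) ^ 2)) |>.sub_const (2 * I / (κ : ℂ) ^ 3)
    refine ((h1.cexp.fun_mul h2).const_mul (Real.pi : ℂ)).congr_deriv ?_
    push_cast
    field_simp
    ring_nf
    simp only [I_sq]
    ring
  rw [intervalIntegral.integral_eq_sub_of_hasDerivAt (fun s _ => hd s)
    (Continuous.intervalIntegrable (by fun_prop) _ _)]
  have e1 : cexp (I * ((κ * t : ℝ) : ℂ)) = Real.cos (κ * t) + Real.sin (κ * t) * I := by
    rw [mul_comm, Complex.exp_mul_I, Complex.ofReal_cos, Complex.ofReal_sin]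
  have e2 : cexp (I * ((κ * -t : ℝ) : ℂ)) = Real.cos (κ * t) - Real.sin (κ * t) * I := by
    rw [mul_comm, Complex.exp_mul_I, ← Complex.ofReal_cos, ← Complex.ofReal_sin, mul_neg,
      Real.cos_neg, Real.sin_neg]
    push_cast; ring
  rw [e1, e2, ballTransform]
  push_cast
  field_simp
  ring_nf
  simp only [I_sq]
  ring

lemma measureReal_disc (r : ℝ) : volume.real {w : Fin 2 → ℝ | w 0 ^ 2 + w 1 ^ 2 < r} =
    Real.pi * max r 0 := by
  rcases le_or_gt r 0 with hr | hr
  · have : {w : Fin 2 → ℝ | w 0 ^ 2 + w 1 ^ 2 < r} = ∅ := by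
      ext w
      simp only [Set.mem_ofPred_eq, Set.mem_empty_iff_false, iff_false, not_lt]
      exact hr.trans (by positivity)
    simp [this, hr]
  · have h1 : {w : Fin 2 → ℝ | w 0 ^ 2 + w 1 ^ 2 < r} =
        (MeasurableEquiv.toLp 2 (Fin 2 → ℝ)) ⁻¹' Metric.ball 0 (Real.sqrt r) := by
      ext w
      simp [EuclideanSpace.norm_eq, Real.sqrt_lt_sqrt_iff_of_pos hr]
    rw [h1, measureReal_def, (PiLp.volume_preserving_toLp (Fin 2)).measure_preimage_equiv,
      EuclideanSpace.volume_ball_fin_two, max_eq_left hr.le]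
    rw [ENNReal.toReal_mul, ENNReal.toReal_pow, ENNReal.toReal_ofReal (Real.sqrt_nonneg _),
      ENNReal.toReal_ofReal Real.pi_pos.le, Real.sq_sqrt hr.le, mul_comm]

lemma integral_ball_cexp_coord (κ : ℝ) {t : ℝ} (ht : 0 ≤ t) :
    ∫ y in Metric.ball (0 : E3) t, cexp (I * ((κ * y 0 : ℝ) : ℂ)) =
      ∫ s in (-t)..t, cexp (I * ((κ * s : ℝ) : ℂ)) * ((Real.pi * (t ^ 2 - s ^ 2) : ℝ) : ℂ) := by
  let f : E3 → ℂ := (Metric.ball (0 : E3) t).indicator fun y => cexp (I * ((κ * y 0 : ℝ) : ℂ))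
  have hfi : Integrable f := by
    refine (integrable_indicator_iff Metric.isOpen_ball.measurableSet).2 ?_
    exact IntegrableOn.mono_set ((Continuous.continuousOn (by fun_prop)).integrableOn_compact
      (isCompact_closedBall (0 : E3) t)) Metric.ball_subset_closedBall
  let e : ℝ × (Fin 2 → ℝ) ≃ᵐ E3 :=
    (MeasurableEquiv.piFinSuccAbove (fun _ : Fin 3 => ℝ) 0).symm.trans
      (MeasurableEquiv.toLp 2 (Fin 3 → ℝ))
  have he : MeasurePreserving e :=
    (PiLp.volume_preserving_toLp (Fin 3)).comp
      (volume_preserving_piFinSuccAbove (fun _ : Fin 3 => ℝ) 0).symm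
  have he0 : ∀ p, (e p) 0 = p.1 := fun p => by
    simp [e, MeasurableEquiv.piFinSuccAbove]
  have hen : ∀ p, ‖e p‖ ^ 2 = p.1 ^ 2 + (p.2 0 ^ 2 + p.2 1 ^ 2) := fun p => by
    rw [EuclideanSpace.real_norm_sq_eq, Fin.sum_univ_succ, Fin.sum_univ_two]
    rfl
  have hfe : ∀ s w, f (e (s, w)) = {w : Fin 2 → ℝ | w 0 ^ 2 + w 1 ^ 2 < t ^ 2 - s ^ 2}.indicator
      (fun _ => cexp (I * ((κ * s : ℝ) : ℂ))) w := by
    intro s w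
    have : e (s, w) ∈ Metric.ball (0 : E3) t ↔
        w ∈ {w : Fin 2 → ℝ | w 0 ^ 2 + w 1 ^ 2 < t ^ 2 - s ^ 2} := by
      rw [mem_ball_zero_iff, ← sq_lt_sq₀ (norm_nonneg _) ht, hen, Set.mem_ofPred_eq,
        lt_sub_iff_add_lt']
    simp only [f, Set.indicator, this, he0]
  rw [← integral_indicator Metric.isOpen_ball.measurableSet]
  change ∫ y, f y = _
  rw [← he.integral_comp' f, Measure.volume_eq_prod, integral_prod]
  swap
  · exact (he.integrable_comp_emb e.measurableEmbedding).2 hfi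
  have hin : ∀ s : ℝ, ∫ w, f (e (s, w)) =
      cexp (I * ((κ * s : ℝ) : ℂ)) * ((Real.pi * max (t ^ 2 - s ^ 2) 0 : ℝ) : ℂ) := by
    intro s
    simp only [hfe]
    rw [integral_indicator_const, measureReal_disc]
    · rw [Complex.real_smul, mul_comm]
    · exact (isOpen_lt (by fun_prop) (by fun_prop)).measurableSet
  simp only [hin]
  rw [intervalIntegral.integral_of_le (by linarith), ← integral_indicator measurableSet_Ioc]
  congr 1
  ext s
  by_cases hs : s ∈ Set.Ioc (-t) t
  · rw [Set.indicator_of_mem hs, max_eq_left]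
    nlinarith [hs.1, hs.2]
  · rw [Set.indicator_of_notMem hs, max_eq_right]
    · simp
    · by_contra! hlt
      have : |s| < t := abs_lt_of_sq_lt_sq (by linarith) ht
      exact hs ⟨(abs_lt.1 this).1, (abs_lt.1 this).2.le⟩

/-- Rotation invariance of the ball: completing `k/|k|` to an orthonormal basis turns the phase into
`|k|` times the first coordinate, and slicing applies. -/
lemma integral_ball_planeWave {k : E3} (hk : k ≠ 0) {t : ℝ} (ht : 0 ≤ t) :
    ∫ x in Metric.ball (0 : E3) t, planeWave k x = (ballTransform ‖k‖ t : ℂ) := by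
  have hk' : ‖k‖ ≠ 0 := norm_ne_zero_iff.2 hk
  obtain ⟨b, hb⟩ := Orthonormal.exists_orthonormalBasis_extension_of_card_eq (𝕜 := ℝ) (E := E3)
    (ι := Fin 3) (by simp) (v := fun _ => ‖k‖⁻¹ • k) (s := {0}) (by
      refine ⟨fun i => ?_, fun i j hij => absurd (Subsingleton.elim i j) hij⟩
      simp [norm_smul, hk'])
  have hb0 : k = ‖k‖ • b 0 := by
    rw [hb 0 rfl, smul_smul, mul_inv_cancel₀ hk', one_smul]
  have hpre : b.repr ⁻¹' Metric.ball 0 t = Metric.ball 0 t := by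
    ext x; simp
  rw [← integral_cexp_mul_sq_sub_sq hk', ← integral_ball_cexp_coord _ ht,
    ← b.measurePreserving_repr.setIntegral_preimage_emb b.repr.toHomeomorph.measurableEmbedding
      (fun y : E3 => cexp (I * ((‖k‖ * y 0 : ℝ) : ℂ))), hpre]
  congr 1
  ext x
  rw [planeWave, b.repr_apply_apply, ← real_inner_smul_left, ← hb0]

/-! ### Free waves and their vanishing inside the light cone -/

lemma abs_sin_mul_div_le (κ t : ℝ) : |Real.sin (κ * t) / κ| ≤ |t| := by
  rcases eq_or_ne κ 0 with rfl | hκ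
  · simp
  rw [abs_div, div_le_iff₀ (abs_pos.2 hκ), ← abs_mul, mul_comm t]
  exact Real.abs_sin_le_abs

/-- The solution at time `t` of the wave equation with initial velocity the inverse Fourier
transform of `m`, up to a constant factor. -/
def waveSin (m : E3 → ℂ) (t : ℝ) (y : E3) : ℂ :=
  ∫ k, planeWave k y * m k * ((Real.sin (‖k‖ * t) / ‖k‖ : ℝ) : ℂ)

/-- The solution at time `t` of the wave equation with initial position the inverse Fourier
transform of `m` and initial velocity zero, up to a constant factor. -/
def waveCos (m : E3 → ℂ) (t : ℝ) (y : E3) : ℂ :=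
  ∫ k, planeWave k y * m k * (Real.cos (‖k‖ * t) : ℂ)

/-- The partial derivative in the direction `e_j` of `waveSin`. -/
def waveSinPartial (m : E3 → ℂ) (j : Fin 3) (t : ℝ) (y : E3) : ℂ :=
  ∫ k, planeWave k y * m k * (I * (k j : ℂ) * ((Real.sin (‖k‖ * t) / ‖k‖ : ℝ) : ℂ))

lemma aestronglyMeasurable_planeWave_mul {m : E3 → ℂ} (hm : Integrable m) (y : E3) {g : E3 → ℂ}
    (hg : Measurable g) : AEStronglyMeasurable fun k => planeWave k y * m k * g k :=
  ((Continuous.aestronglyMeasurable (by fun_prop)).mul hm.aestronglyMeasurable).mul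
    hg.aestronglyMeasurable

/-- **Huygens' principle**: if the initial velocity is supported in the ball of radius `R`, then
the solution of the wave equation vanishes at time `t` in the ball of radius `t - R`. -/
lemma waveSin_eq_zero {m : E3 → ℂ} (hm : Integrable m) {R : ℝ}
    (hR : ∀ x, R < ‖x‖ → ∫ k, planeWave k x * m k = 0) {y : E3} {t : ℝ} (ht0 : 0 < t)
    (ht : ‖y‖ + R < t) : waveSin m t y = 0 := by
  -- Volume integrals replace spherical means: with `M(x) = ∫ e^{ik·x} m(k) dk`, the left side is
  -- the integral of `M` over the ball of radius `t` about `y`.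
  have hswap : ∀ t : ℝ, 0 ≤ t → ∫ k, planeWave k y * m k * (ballTransform ‖k‖ t : ℂ) =
      ∫ x in Metric.ball (0 : E3) t, ∫ k, planeWave k (y + x) * m k := by
    intro t ht
    rw [integral_integral_swap]
    · refine integral_congr_ae ?_
      filter_upwards [compl_mem_ae_iff.2 (measure_singleton (0 : E3))] with k hk
      rw [← integral_ball_planeWave hk ht, ← integral_const_mul]
      congr 1; ext x
      rw [planeWave_add_right]; ring
    · have h1 : Integrable (fun p : E3 × E3 => (1 : ℂ) * m p.2)
          ((volume.restrict (Metric.ball (0 : E3) t)).prod volume) := by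
        have : IsFiniteMeasure (volume.restrict (Metric.ball (0 : E3) t)) :=
          ⟨by rw [Measure.restrict_apply_univ]; exact measure_ball_lt_top⟩
        exact (integrable_const (1 : ℂ)).mul_prod hm
      refine (h1.bdd_mul (c := 1) (f := fun p : E3 × E3 => planeWave p.2 (y + p.1))
        (Continuous.aestronglyMeasurable (by fun_prop)) (by simp)).congr
        (Filter.Eventually.of_forall fun p => ?_)
      simp [Function.uncurry]
  -- Once that ball contains the ball of radius `R` about the origin, enlarging it only adds points
  -- where `M` vanishes.
  have hconst : ∀ t₁ : ℝ, ‖y‖ + R < t₁ → 0 < t₁ → ∀ t₂ : ℝ, t₁ ≤ t₂ →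
      ∫ k, planeWave k y * m k * (ballTransform ‖k‖ t₂ : ℂ) =
      ∫ k, planeWave k y * m k * (ballTransform ‖k‖ t₁ : ℂ) := by
    intro t₁ h1 h0 t₂ h2
    rw [hswap t₁ h0.le, hswap t₂ (h0.le.trans h2)]
    refine (setIntegral_eq_of_subset_of_forall_sdiff_eq_zero Metric.isOpen_ball.measurableSet
      (Metric.ball_subset_ball h2) fun x hx => hR _ ?_)
    have hx1 : t₁ ≤ ‖x‖ := by simpa using hx.2
    have : ‖x‖ ≤ ‖y + x‖ + ‖y‖ := by
      simpa using norm_sub_le (y + x) y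
    linarith
  -- The `t`-derivative of the volume integral is `4πt` times `waveSin`, so local constancy in `t`
  -- forces `waveSin` to vanish.
  have hder : HasDerivAt (fun t => ∫ k, planeWave k y * m k * (ballTransform ‖k‖ t : ℂ))
      (∫ k, planeWave k y * m k *
        ((4 * Real.pi * t * (Real.sin (‖k‖ * t) / ‖k‖) : ℝ) : ℂ)) t := by
    have hmeas : ∀ t, AEStronglyMeasurable fun k : E3 =>
        planeWave k y * m k * (ballTransform ‖k‖ t : ℂ) := fun t =>
      aestronglyMeasurable_planeWave_mul hm y (by unfold ballTransform; fun_prop)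
    refine (hasDerivAt_integral_of_dominated_loc_of_deriv_le
      (F' := fun t k => planeWave k y * m k *
        ((4 * Real.pi * t * (Real.sin (‖k‖ * t) / ‖k‖) : ℝ) : ℂ))
      (bound := fun k => ‖m k‖ * (4 * Real.pi * (t + 1) * (t + 1)))
      (Metric.ball_mem_nhds t one_pos) (Filter.Eventually.of_forall hmeas) ?_ ?_ ?_ ?_ ?_).2
    · refine (hm.norm.mul_const (volume.real (Metric.ball (0 : E3) t))).mono' (hmeas t) ?_
      filter_upwards [compl_mem_ae_iff.2 (measure_singleton (0 : E3))] with k hk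
      rw [norm_mul, norm_mul, norm_planeWave, one_mul, ← integral_ball_planeWave hk ht0.le]
      gcongr
      refine (norm_setIntegral_le_of_norm_le_const (C := 1) measure_ball_lt_top
        (fun x _ => (norm_planeWave k x).le)).trans (by rw [one_mul])
    · exact aestronglyMeasurable_planeWave_mul hm y (by fun_prop)
    · refine Filter.Eventually.of_forall fun k s hs => ?_
      have hs' := abs_lt.1 (by simpa [Real.dist_eq] using hs : |s - t| < 1)
      have hsa : |s| ≤ t + 1 := abs_le.2 ⟨by linarith, by linarith⟩
      rw [norm_mul, norm_mul, norm_planeWave, one_mul, Complex.norm_real, Real.norm_eq_abs,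
        abs_mul, abs_mul, abs_of_pos (by positivity : 0 < 4 * Real.pi)]
      gcongr
      exact (abs_sin_mul_div_le _ _).trans hsa
    · exact hm.norm.mul_const _
    · exact Filter.Eventually.of_forall fun k s _ =>
        (hasDerivAt_ballTransform ‖k‖ s).ofReal_comp.const_mul _
  have hmax : max (‖y‖ + R) 0 < t := max_lt ht ht0
  obtain ⟨t₁, h1, h2⟩ := exists_between hmax
  have hzero := hder.congr_of_eventuallyEq (f₁ := fun _ =>
      ∫ k, planeWave k y * m k * (ballTransform ‖k‖ t₁ : ℂ)) (by
    filter_upwards [lt_mem_nhds h2] with s hs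
    exact (hconst t₁ ((le_max_left _ _).trans_lt h1) ((le_max_right _ _).trans_lt h1) s hs.le).symm)
  have h3 := hzero.unique (hasDerivAt_const t _)
  have h4 : ∫ k, planeWave k y * m k *
        ((4 * Real.pi * t * (Real.sin (‖k‖ * t) / ‖k‖) : ℝ) : ℂ)
      = ((4 * Real.pi * t : ℝ) : ℂ) * waveSin m t y := by
    rw [waveSin, ← integral_const_mul]
    congr 1; ext k; push_cast; ring
  rw [h4] at h3
  refine (mul_eq_zero.1 h3).resolve_left (Complex.ofReal_ne_zero.2 (by positivity))

lemma integrable_waveSin {m : E3 → ℂ} (hm : Integrable m) (t : ℝ) (y : E3) :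
    Integrable fun k => planeWave k y * m k * ((Real.sin (‖k‖ * t) / ‖k‖ : ℝ) : ℂ) := by
  refine (hm.norm.mul_const |t|).mono' (aestronglyMeasurable_planeWave_mul hm y (by fun_prop))
    (Filter.Eventually.of_forall fun k => ?_)
  rw [norm_mul, norm_mul, norm_planeWave, one_mul, Complex.norm_real]
  exact mul_le_mul_of_nonneg_left (abs_sin_mul_div_le _ _) (norm_nonneg _)

/-- `waveCos` is the time derivative of `waveSin`, which vanishes at all nearby times because the
condition on `t` is open. -/
lemma waveCos_eq_zero {m : E3 → ℂ} (hm : Integrable m) {R : ℝ}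
    (hR : ∀ x, R < ‖x‖ → ∫ k, planeWave k x * m k = 0) {y : E3} {t : ℝ} (ht0 : 0 < t)
    (ht : ‖y‖ + R < t) : waveCos m t y = 0 := by
  have hder : HasDerivAt (fun t => waveSin m t y) (waveCos m t y) t := by
    refine (hasDerivAt_integral_of_dominated_loc_of_deriv_le
      (F' := fun t k => planeWave k y * m k * (Real.cos (‖k‖ * t) : ℂ))
      (bound := fun k => ‖m k‖) Filter.univ_mem
      (Filter.Eventually.of_forall fun s => (integrable_waveSin hm s y).aestronglyMeasurable)
      (integrable_waveSin hm t y) ?_ ?_ hm.norm ?_).2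
    · exact aestronglyMeasurable_planeWave_mul hm y (by fun_prop)
    · refine Filter.Eventually.of_forall fun k s _ => ?_
      rw [norm_mul, norm_mul, norm_planeWave, one_mul, Complex.norm_real]
      exact mul_le_of_le_one_right (norm_nonneg _) (Real.abs_cos_le_one _)
    · filter_upwards [compl_mem_ae_iff.2 (measure_singleton (0 : E3))] with k hk s _
      have hk' : ‖k‖ ≠ 0 := norm_ne_zero_iff.2 hk
      have h1 : HasDerivAt (fun t : ℝ => ‖k‖ * t) ‖k‖ s := by
        simpa using (hasDerivAt_id s).const_mul ‖k‖
      refine ((h1.sin.div_const ‖k‖).congr_deriv ?_).ofReal_comp.const_mul _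
      rw [mul_div_assoc, div_self hk', mul_one]
  have hzero := hder.congr_of_eventuallyEq (f₁ := fun _ => 0) (by
    filter_upwards [lt_mem_nhds ht, lt_mem_nhds ht0] with s hs hs0
    exact (waveSin_eq_zero hm hR hs0 hs).symm)
  exact hzero.unique (hasDerivAt_const t _)

lemma norm_coord_mul_sin_div_le (k : E3) (j : Fin 3) (t : ℝ) :
    ‖I * (k j : ℂ) * ((Real.sin (‖k‖ * t) / ‖k‖ : ℝ) : ℂ)‖ ≤ 1 := by
  rw [norm_mul, norm_mul, Complex.norm_I, one_mul, Complex.norm_real, Complex.norm_real,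
    norm_div, norm_norm, ← mul_div_assoc]
  refine div_le_one_of_le₀ ?_ (norm_nonneg _)
  calc _ ≤ ‖k‖ * 1 := mul_le_mul (PiLp.norm_apply_le k j) (Real.abs_sin_le_one _)
        (abs_nonneg _) (norm_nonneg _)
    _ = _ := mul_one _

/-- The same argument in space: `waveSin` vanishes on a short segment through `y` in the direction
`e_j`. -/
lemma waveSinPartial_eq_zero {m : E3 → ℂ} (hm : Integrable m) {R : ℝ}
    (hR : ∀ x, R < ‖x‖ → ∫ k, planeWave k x * m k = 0) (j : Fin 3) {y : E3} {t : ℝ}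
    (ht0 : 0 < t) (ht : ‖y‖ + R < t) : waveSinPartial m j t y = 0 := by
  have hder : HasDerivAt (fun s : ℝ => waveSin m t (y + s • basisVec j))
      (waveSinPartial m j t y) 0 := by
    have h := (hasDerivAt_integral_of_dominated_loc_of_deriv_le (x₀ := (0 : ℝ))
      (F := fun s k => planeWave k (y + s • basisVec j) * m k *
        ((Real.sin (‖k‖ * t) / ‖k‖ : ℝ) : ℂ))
      (F' := fun s k => planeWave k (y + s • basisVec j) * m k *
        (I * (k j : ℂ) * ((Real.sin (‖k‖ * t) / ‖k‖ : ℝ) : ℂ)))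
      (bound := fun k => ‖m k‖) Filter.univ_mem
      (Filter.Eventually.of_forall fun s => (integrable_waveSin hm t _).aestronglyMeasurable)
      (integrable_waveSin hm t _) ?_ ?_ hm.norm ?_).2
    · simpa [waveSin, waveSinPartial] using h
    · exact aestronglyMeasurable_planeWave_mul hm _ (by fun_prop)
    · refine Filter.Eventually.of_forall fun k s _ => ?_
      rw [norm_mul, norm_mul, norm_planeWave, one_mul]
      exact mul_le_of_le_one_right (norm_nonneg _) (norm_coord_mul_sin_div_le k j t)
    · refine Filter.Eventually.of_forall fun k s _ => ?_
      have h1 := hasDerivAt_planeWave_right k y (basisVec j) s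
      refine ((h1.mul_const (m k)).mul_const _).congr_deriv ?_
      rw [inner_basisVec]
      ring
  have hcont : Filter.Tendsto (fun s : ℝ => ‖y + s • basisVec j‖ + R) (nhds 0)
      (nhds (‖y‖ + R)) := by
    have : Continuous fun s : ℝ => ‖y + s • basisVec j‖ + R := by fun_prop
    simpa using this.tendsto 0
  have hzero := hder.congr_of_eventuallyEq (f₁ := fun _ => 0) (by
    filter_upwards [hcont.eventually (gt_mem_nhds ht)] with s hs
    exact (waveSin_eq_zero hm hR ht0 hs).symm)
  exact hzero.unique (hasDerivAt_const 0 _)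

lemma norm_waveCos_le {m : E3 → ℂ} (hm : Integrable m) (t : ℝ) (y : E3) :
    ‖waveCos m t y‖ ≤ ∫ k, ‖m k‖ := by
  refine norm_integral_le_of_norm_le hm.norm (Filter.Eventually.of_forall fun k => ?_)
  rw [norm_mul, norm_mul, norm_planeWave, one_mul, Complex.norm_real]
  exact mul_le_of_le_one_right (norm_nonneg _) (Real.abs_cos_le_one _)

lemma norm_waveSinPartial_le {m : E3 → ℂ} (hm : Integrable m) (j : Fin 3) (t : ℝ) (y : E3) :
    ‖waveSinPartial m j t y‖ ≤ ∫ k, ‖m k‖ := by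
  refine norm_integral_le_of_norm_le hm.norm (Filter.Eventually.of_forall fun k => ?_)
  rw [norm_mul, norm_mul, norm_planeWave, one_mul]
  exact mul_le_of_le_one_right (norm_nonneg _) (norm_coord_mul_sin_div_le k j t)

/-! ### Laplace transforms -/

lemma add_sq_ne_zero_of_re_pos {s : ℂ} (hs : 0 < s.re) (κ : ℝ) : ((κ ^ 2 : ℝ) : ℂ) + s ^ 2 ≠ 0 := by
  have h : ((κ ^ 2 : ℝ) : ℂ) + s ^ 2 = (s - I * κ) * (s + I * κ) := by
    push_cast
    linear_combination ((κ : ℂ) ^ 2) * I_sq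
  rw [h]
  refine mul_ne_zero (fun h0 => hs.ne' ?_) (fun h0 => hs.ne' ?_)
  · simpa using congrArg Complex.re h0
  · simpa using congrArg Complex.re h0

lemma integral_exp_neg_mul_exp {s : ℂ} (hs : 0 < s.re) (κ : ℝ) :
    IntegrableOn (fun t : ℝ => cexp (-(s * t)) * cexp (I * ((κ * t : ℝ) : ℂ))) (Set.Ioi 0) ∧
    ∫ t : ℝ in Set.Ioi 0, cexp (-(s * t)) * cexp (I * ((κ * t : ℝ) : ℂ)) = (s - I * κ)⁻¹ := by
  have ha : (-s + I * κ).re < 0 := by simpa using hs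
  have he : ∀ t : ℝ, cexp (-(s * t)) * cexp (I * ((κ * t : ℝ) : ℂ)) =
      cexp ((-s + I * κ) * t) := fun t => by
    rw [← Complex.exp_add]; congr 1; push_cast; ring
  simp only [he]
  refine ⟨integrableOn_exp_mul_complex_Ioi ha 0, ?_⟩
  rw [integral_exp_mul_complex_Ioi ha 0, show -s + I * κ = -(s - I * κ) by ring]
  rw [neg_div_neg_eq]
  simp

lemma integral_exp_neg_mul_cos {s : ℂ} (hs : 0 < s.re) (κ : ℝ) :
    ∫ t : ℝ in Set.Ioi 0, cexp (-(s * t)) * (Real.cos (κ * t) : ℂ) =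
      s / (((κ ^ 2 : ℝ) : ℂ) + s ^ 2) := by
  obtain ⟨h1, h2⟩ := integral_exp_neg_mul_exp hs κ
  obtain ⟨h3, h4⟩ := integral_exp_neg_mul_exp hs (-κ)
  have he : ∀ t : ℝ, cexp (-(s * t)) * (Real.cos (κ * t) : ℂ) =
      2⁻¹ * (cexp (-(s * t)) * cexp (I * ((κ * t : ℝ) : ℂ))
        + cexp (-(s * t)) * cexp (I * ((-κ * t : ℝ) : ℂ))) := fun t => by
    rw [Complex.ofReal_cos, Complex.cos, mul_comm I, mul_comm I]
    push_cast
    ring_nf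
  simp only [he]
  rw [integral_const_mul, integral_add h1 h3, h2, h4]
  have hn := add_sq_ne_zero_of_re_pos hs κ
  have hf : ((κ ^ 2 : ℝ) : ℂ) + s ^ 2 = (s - I * κ) * (s - I * ((-κ : ℝ) : ℂ)) := by
    push_cast
    linear_combination ((κ : ℂ) ^ 2) * I_sq
  rw [hf] at hn ⊢
  have hn1 := left_ne_zero_of_mul hn
  have hn2 := right_ne_zero_of_mul hn
  field_simp
  push_cast
  ring

lemma integral_exp_neg_mul_sin {s : ℂ} (hs : 0 < s.re) {κ : ℝ} (hκ : κ ≠ 0) :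
    ∫ t : ℝ in Set.Ioi 0, cexp (-(s * t)) * ((Real.sin (κ * t) / κ : ℝ) : ℂ) =
      (((κ ^ 2 : ℝ) : ℂ) + s ^ 2)⁻¹ := by
  have hκ' : (κ : ℂ) ≠ 0 := Complex.ofReal_ne_zero.2 hκ
  obtain ⟨h1, h2⟩ := integral_exp_neg_mul_exp hs κ
  obtain ⟨h3, h4⟩ := integral_exp_neg_mul_exp hs (-κ)
  have he : ∀ t : ℝ, cexp (-(s * t)) * ((Real.sin (κ * t) / κ : ℝ) : ℂ) =
      (I * (2 * (κ : ℂ))⁻¹) * (cexp (-(s * t)) * cexp (I * ((-κ * t : ℝ) : ℂ))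
        - cexp (-(s * t)) * cexp (I * ((κ * t : ℝ) : ℂ))) := fun t => by
    rw [Complex.ofReal_div, Complex.ofReal_sin, Complex.sin, mul_comm I (((-κ * t : ℝ) : ℂ)),
      mul_comm I ((κ * t : ℝ) : ℂ)]
    push_cast
    field_simp
  simp only [he]
  rw [integral_const_mul, integral_sub h3 h1, h2, h4]
  have hn := add_sq_ne_zero_of_re_pos hs κ
  have hf : ((κ ^ 2 : ℝ) : ℂ) + s ^ 2 = (s - I * κ) * (s - I * ((-κ : ℝ) : ℂ)) := by
    push_cast
    linear_combination ((κ : ℂ) ^ 2) * I_sq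
  rw [hf] at hn ⊢
  have hn1 := left_ne_zero_of_mul hn
  have hn2 := right_ne_zero_of_mul hn
  field_simp
  push_cast
  linear_combination (-2 * (κ : ℂ)) * I_sq

/-- Mean value inequality on the convex left half-plane, where the derivative of `exp` has modulus
at most one. -/
lemma norm_exp_sub_one_le_of_re_nonpos {w : ℂ} (hw : w.re ≤ 0) : ‖cexp w - 1‖ ≤ ‖w‖ := by
  have h := Convex.norm_image_sub_le_of_norm_deriv_le (𝕜 := ℂ) (f := cexp) (C := 1)
    (s := {z : ℂ | z.re ≤ 0}) (x := 0) (y := w) (fun z _ => Complex.differentiableAt_exp)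
    (fun z hz => by
      rw [Complex.deriv_exp, Complex.norm_exp]
      exact Real.exp_le_one_iff.2 hz)
    (convex_halfSpace_re_le 0) (by simp) hw
  simpa using h

/-- In the closed half-plane `|(e^{-zt} - 1)/z| ≤ t`, so the integrable function `t|F(t)|` dominates
every difference quotient, uniformly in the direction of approach to `0`. -/
lemma hasDerivWithinAt_laplace {F : ℝ → ℂ} (hF : IntegrableOn F (Set.Ioi 0))
    (htF : IntegrableOn (fun t : ℝ => (t : ℂ) * F t) (Set.Ioi 0)) :
    HasDerivWithinAt (fun z : ℂ => ∫ t : ℝ in Set.Ioi 0, cexp (-(z * t)) * F t)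
      (-∫ t : ℝ in Set.Ioi 0, (t : ℂ) * F t) {z : ℂ | 0 ≤ z.re} 0 := by
  rw [hasDerivWithinAt_iff_tendsto_slope]
  have hint : ∀ z ∈ {z : ℂ | 0 ≤ z.re},
      IntegrableOn (fun t : ℝ => cexp (-(z * t)) * F t) (Set.Ioi 0) := by
    intro z hz
    refine hF.bdd_mul (c := 1) (Continuous.aestronglyMeasurable (by fun_prop)) ?_
    refine (ae_restrict_iff' measurableSet_Ioi).2 (Filter.Eventually.of_forall fun t ht => ?_)
    rw [Complex.norm_exp]
    refine Real.exp_le_one_iff.2 ?_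
    simpa using mul_nonneg hz (le_of_lt ht)
  have hslope : ∀ z ∈ {z : ℂ | 0 ≤ z.re} \ {0},
      ∫ t : ℝ in Set.Ioi 0, (cexp (-(z * t)) - 1) / z * F t =
      slope (fun z : ℂ => ∫ t : ℝ in Set.Ioi 0, cexp (-(z * t)) * F t) 0 z := by
    intro z hz
    rw [slope_def_field, ← integral_sub (hint z hz.1) (hint 0 (by simp)), sub_zero,
      ← integral_div]
    congr 1; ext t
    simp only [zero_mul, neg_zero, Complex.exp_zero]
    ring
  rw [← integral_neg]
  refine Filter.Tendsto.congr' (Filter.eventually_of_mem self_mem_nhdsWithin hslope) ?_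
  refine tendsto_integral_filter_of_dominated_convergence (fun t : ℝ => ‖(t : ℂ) * F t‖) ?_ ?_
    htF.norm ?_
  · exact Filter.Eventually.of_forall fun z =>
      (Continuous.aestronglyMeasurable (by fun_prop)).mul hF.aestronglyMeasurable
  · refine Filter.eventually_of_mem self_mem_nhdsWithin fun z hz => ?_
    refine (ae_restrict_iff' measurableSet_Ioi).2 (Filter.Eventually.of_forall fun t ht => ?_)
    have ht' : (0 : ℝ) < t := ht
    have hz0 : 0 < ‖z‖ := norm_pos_iff.2 hz.2
    rw [norm_mul, norm_mul, norm_div, Complex.norm_real, Real.norm_eq_abs, abs_of_pos ht']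
    gcongr
    rw [div_le_iff₀ hz0]
    refine (norm_exp_sub_one_le_of_re_nonpos ?_).trans (le_of_eq ?_)
    · simpa using mul_nonneg hz.1 ht'.le
    · rw [norm_neg, norm_mul, Complex.norm_real, Real.norm_eq_abs, abs_of_pos ht', mul_comm]
  · refine Filter.Eventually.of_forall fun t => ?_
    have h1 : HasDerivAt (fun z : ℂ => cexp (-(z * t))) (-(t : ℂ)) 0 := by
      simpa using (((hasDerivAt_id (0 : ℂ)).mul_const (t : ℂ)).fun_neg).cexp
    have h2 := (hasDerivAt_iff_tendsto_slope.1 h1).mono_left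
      (nhdsWithin_mono 0 (fun z (hz : z ∈ {z : ℂ | 0 ≤ z.re} \ {0}) => hz.2))
    have h3 := h2.mul_const (F t)
    refine (h3.congr fun z => ?_).trans_eq (by rw [neg_mul])
    rw [slope_def_field]
    simp

/-! ### The time representation of `Φ` -/

/-- The factor `-ĝ cos(|k|t) + i k_j f̂ sin(|k|t)/|k|`. -/
def timeFactor (g f : E3 → ℝ) (j : Fin 3) (t : ℝ) (k : E3) : ℂ :=
  -(fourierHat g k * (Real.cos (‖k‖ * t) : ℂ)) +
    fourierHat f k * (I * (k j : ℂ) * ((Real.sin (‖k‖ * t) / ‖k‖ : ℝ) : ℂ))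

/-- The function of time whose Laplace transform is the `j`-th component of `Φ`; here `g` is the
weak derivative `∂_j Ψ₀` and `f` is `Π₀`. -/
def phiTime (ρ : E3 → ℝ) (v : E3) (g f : E3 → ℝ) (j : Fin 3) (t : ℝ) : ℂ :=
  ∫ k, planeWave k (-(t • v)) * conj (fourierHat ρ k) * timeFactor g f j t k

lemma exists_norm_timeFactor_le (g f : E3 → ℝ) (j : Fin 3) :
    ∃ C, ∀ t k, ‖timeFactor g f j t k‖ ≤ C := by
  refine ⟨‖fourierConst‖ * (∫ x, |g x|) + ‖fourierConst‖ * ∫ x, |f x|, fun t k => ?_⟩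
  refine (norm_add_le _ _).trans (add_le_add ?_ ?_)
  · rw [norm_neg, norm_mul, Complex.norm_real]
    exact (mul_le_of_le_one_right (norm_nonneg _) (Real.abs_cos_le_one _)).trans
      (norm_fourierHat_le g k)
  · rw [norm_mul]
    exact (mul_le_of_le_one_right (norm_nonneg _) (norm_coord_mul_sin_div_le k j t)).trans
      (norm_fourierHat_le f k)

lemma measurable_timeFactor {g f : E3 → ℝ} (hg : Integrable g) (hf : Integrable f) (j : Fin 3) :
    Measurable fun p : E3 × ℝ => timeFactor g f j p.2 p.1 := by
  have h1 := (continuous_fourierHat hg).measurable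
  have h2 := (continuous_fourierHat hf).measurable
  unfold timeFactor
  fun_prop

lemma continuous_timeFactor (g f : E3 → ℝ) (j : Fin 3) (k : E3) :
    Continuous fun t => timeFactor g f j t k := by
  unfold timeFactor
  fun_prop

/-- The factor `e^{-it k·v}` shifts the Laplace variable from `z` to `s = ik·v + z`. The transforms
of `cos` and `sin/|k|` then have the common denominator `k² + s² = symbolD`, and `-ĝ = ik_j Ψ̂`
supplies the numerator. -/
lemma integral_exp_mul_timeFactor (ρ : E3 → ℝ) (v : E3) {Ψ g f : E3 → ℝ} {j : Fin 3}
    (hΨ : ∀ k : E3, fourierHat g k = -(I * (k j : ℂ)) * fourierHat Ψ k) {z : ℂ} (hz : 0 < z.re)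
    {k : E3} (hk : k ≠ 0) :
    ∫ t in Set.Ioi (0 : ℝ), cexp (-(z * t)) * (planeWave k (-(t • v)) *
      conj (fourierHat ρ k) * timeFactor g f j t k) = I * phiIntegrand ρ v Ψ f z j k := by
  set s : ℂ := I * (⟪k, v⟫_ℝ : ℂ) + z with hs
  have hsre : 0 < s.re := by simpa [hs] using hz
  have hk' : ‖k‖ ≠ 0 := norm_ne_zero_iff.2 hk
  have he : ∀ t : ℝ, cexp (-(z * t)) * planeWave k (-(t • v)) = cexp (-(s * t)) := fun t => by
    rw [planeWave, ← Complex.exp_add, inner_neg_right, real_inner_smul_right, hs]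
    congr 1; push_cast; ring
  have he' : ∀ t : ℝ, cexp (-(z * t)) * (planeWave k (-(t • v)) *
      conj (fourierHat ρ k) * timeFactor g f j t k) =
      (-(fourierHat g k) * conj (fourierHat ρ k)) * (cexp (-(s * t)) * (Real.cos (‖k‖ * t) : ℂ)) +
      (fourierHat f k * (I * (k j : ℂ)) * conj (fourierHat ρ k)) *
        (cexp (-(s * t)) * ((Real.sin (‖k‖ * t) / ‖k‖ : ℝ) : ℂ)) := fun t => by
    rw [← he, timeFactor]; ring
  have hexp : IntegrableOn (fun t : ℝ => cexp (-s * t)) (Set.Ioi 0) :=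
    integrableOn_exp_mul_complex_Ioi (by simpa using hsre) 0
  simp only [neg_mul] at hexp
  have hi1 : IntegrableOn (fun t : ℝ => cexp (-(s * t)) * (Real.cos (‖k‖ * t) : ℂ)) (Set.Ioi 0) :=
    hexp.mul_bdd (c := 1) (Continuous.aestronglyMeasurable (by fun_prop))
      (Filter.Eventually.of_forall fun t => by
        rw [Complex.norm_real]; exact Real.abs_cos_le_one _)
  have hi2 : IntegrableOn (fun t : ℝ => cexp (-(s * t)) * ((Real.sin (‖k‖ * t) / ‖k‖ : ℝ) : ℂ))
      (Set.Ioi 0) :=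
    hexp.mul_bdd (c := 1 / ‖k‖) (Continuous.aestronglyMeasurable (by fun_prop))
      (Filter.Eventually.of_forall fun t => by
        rw [Complex.norm_real, norm_div, norm_norm]
        gcongr
        exact Real.abs_sin_le_one _)
  simp only [he']
  rw [integral_add (hi1.const_mul _) (hi2.const_mul _), integral_const_mul, integral_const_mul,
    integral_exp_neg_mul_cos hsre, integral_exp_neg_mul_sin hsre hk', phiIntegrand, symbolD, ← hs,
    hΨ]
  field_simp

namespace IsChargeDistribution

variable {ρ : E3 → ℝ} (hρ : IsChargeDistribution ρ)
include hρ

lemma continuous_phiTime (v : E3) {g f : E3 → ℝ} (hg : Integrable g) (hf : Integrable f)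
    (j : Fin 3) : Continuous (phiTime ρ v g f j) := by
  obtain ⟨C, hC⟩ := exists_norm_timeFactor_le g f j
  refine continuous_of_dominated (bound := fun k => ‖fourierHat ρ k‖ * C) (fun t => ?_)
    (fun t => Filter.Eventually.of_forall fun k => ?_)
    (hρ.integrable_fourierHat.norm.mul_const C) (Filter.Eventually.of_forall fun k => ?_)
  · have h1 := hρ.continuous_fourierHat
    have h2 := (measurable_timeFactor hg hf j).comp (measurable_prodMk_right (y := t))
    exact (Continuous.aestronglyMeasurable (by fun_prop)).mul h2.aestronglyMeasurable
  · rw [norm_mul, norm_mul, norm_planeWave, one_mul, RCLike.norm_conj]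
    gcongr
    exact hC t k
  · have := continuous_timeFactor g f j k
    fun_prop

lemma integrable_exp_mul_timeFactor (v : E3) {g f : E3 → ℝ} (hg : Integrable g)
    (hf : Integrable f) (j : Fin 3) {z : ℂ} (hz : 0 < z.re) :
    Integrable (fun p : E3 × ℝ => cexp (-(z * p.2)) * (planeWave p.1 (-(p.2 • v)) *
      conj (fourierHat ρ p.1) * timeFactor g f j p.2 p.1))
      (volume.prod (volume.restrict (Set.Ioi 0))) := by
  obtain ⟨C, hC⟩ := exists_norm_timeFactor_le g f j
  have he : IntegrableOn (fun t : ℝ => Real.exp (-z.re * t)) (Set.Ioi 0) :=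
    exp_neg_integrableOn_Ioi 0 hz
  have h1 := hρ.continuous_fourierHat
  refine ((hρ.integrable_fourierHat.norm.mul_const C).mul_prod he).mono' ?_
    (Filter.Eventually.of_forall fun p => ?_)
  · exact (Continuous.aestronglyMeasurable (by fun_prop)).mul
      ((Continuous.aestronglyMeasurable (by fun_prop)).mul
        (measurable_timeFactor hg hf j).aestronglyMeasurable)
  · rw [norm_mul, norm_mul, norm_mul, norm_planeWave, one_mul, RCLike.norm_conj, Complex.norm_exp,
      mul_comm]
    have : (-(z * (p.2 : ℂ))).re = -z.re * p.2 := by simp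
    rw [this]
    gcongr
    exact hC _ _

lemma integrable_phiIntegrand_of_re_pos (v : E3) {Ψ g f : E3 → ℝ} {j : Fin 3} (hg : Integrable g)
    (hf : Integrable f) (hΨ : ∀ k : E3, fourierHat g k = -(I * (k j : ℂ)) * fourierHat Ψ k)
    {z : ℂ} (hz : 0 < z.re) : Integrable (phiIntegrand ρ v Ψ f z j) := by
  have h := (hρ.integrable_exp_mul_timeFactor v hg hf j hz).integral_prod_left.const_mul (-I)
  refine h.congr ?_
  filter_upwards [compl_mem_ae_iff.2 (measure_singleton (0 : E3))] with k hk
  rw [integral_exp_mul_timeFactor ρ v hΨ hz hk]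
  linear_combination (-phiIntegrand ρ v Ψ f z j k) * I_sq

/-- Fubini applies because the time factor is bounded, `ρ̂` is integrable and `|e^{-zt}|` decays. -/
lemma Phi_eq_laplace (v : E3) {Ψ g f : E3 → ℝ} {j : Fin 3} (hg : Integrable g)
    (hf : Integrable f) (hΨ : ∀ k : E3, fourierHat g k = -(I * (k j : ℂ)) * fourierHat Ψ k)
    {z : ℂ} (hz : 0 < z.re) :
    Phi ρ v Ψ f z j = ∫ t in Set.Ioi (0 : ℝ), cexp (-(z * t)) * phiTime ρ v g f j t := by
  have h := integral_integral_swap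
    (f := fun (k : E3) (t : ℝ) => cexp (-(z * t)) * (planeWave k (-(t • v)) *
      conj (fourierHat ρ k) * timeFactor g f j t k))
    (hρ.integrable_exp_mul_timeFactor v hg hf j hz)
  simp only [phiTime, ← integral_const_mul]
  rw [← h, Phi, ← integral_const_mul]
  refine integral_congr_ae ?_
  filter_upwards [compl_mem_ae_iff.2 (measure_singleton (0 : E3))] with k hk
  exact (integral_exp_mul_timeFactor ρ v hΨ hz hk).symm

end IsChargeDistribution

/-! ### Decay in time -/

/-- Shifts the multiplier `q` from the initial data `f` to `m`, so that Huygens' principle can be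
used for the compactly supported charge. -/
lemma integral_planeWave_mul_fourierHat_mul {m : E3 → ℂ} (hm : Integrable m) {f : E3 → ℝ}
    (hf : Integrable f) {q : E3 → ℂ} (hq : Measurable q) (hq1 : ∀ k, ‖q k‖ ≤ 1) (y : E3) :
    ∫ k, planeWave k y * m k * (fourierHat f k * q k) =
      fourierConst * ∫ x, (f x : ℂ) * ∫ k, planeWave k (x + y) * m k * q k := by
  have hint : Integrable (fun p : E3 × E3 => m p.1 * (f p.2 : ℂ)) (volume.prod volume) :=
    hm.mul_prod (hf.ofReal (𝕜 := ℂ))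
  have hbd : ∀ p : E3 × E3, ‖planeWave p.1 (p.2 + y) * q p.1‖ ≤ 1 := fun p => by
    rw [norm_mul, norm_planeWave, one_mul]; exact hq1 _
  have hmeas : AEStronglyMeasurable (fun p : E3 × E3 => planeWave p.1 (p.2 + y) * q p.1)
      (volume.prod volume) :=
    (Continuous.aestronglyMeasurable (by fun_prop)).mul
      (hq.comp measurable_fst).aestronglyMeasurable
  have hswap := integral_integral_swap
    (f := fun k x : E3 => planeWave k (x + y) * q k * (m k * (f x : ℂ)))
    (hint.bdd_mul (c := 1) hmeas (Filter.Eventually.of_forall hbd))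
  have h1 : ∀ k, planeWave k y * m k * (fourierHat f k * q k) =
      fourierConst * ∫ x, planeWave k (x + y) * q k * (m k * (f x : ℂ)) := fun k => by
    have : ∀ x, planeWave k (x + y) * q k * (m k * (f x : ℂ)) =
        (planeWave k y * q k * m k) * (planeWave k x * (f x : ℂ)) := fun x => by
      rw [planeWave_add_right]; ring
    simp only [this]
    rw [integral_const_mul, fourierHat_eq]
    ring
  simp only [h1]
  rw [integral_const_mul, hswap]
  congr 2; ext x
  rw [← integral_const_mul]
  congr 1; ext k; ring

/-- Where `K` may be nonzero, `t ≤ |x - tv| + R ≤ |x| + t|v| + R`, so `|x|` grows at least like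
`(1-|v|)t`; the weight on `f` is thereby traded for decay in `t`. -/
lemma norm_integral_mul_le_of_light_cone {f : E3 → ℝ} {q : ℝ} (hq : 0 ≤ q)
    (hf : Integrable fun x => (1 + ‖x‖) ^ q * f x) {K : E3 → ℂ} {M : ℝ}
    (hM : ∀ x, ‖K x‖ ≤ M) {v : E3} (hv : ‖v‖ < 1) {R : ℝ} (hR : 0 ≤ R) {t : ℝ} (ht : 0 < t)
    (hK : ∀ x, ‖x + -(t • v)‖ + R < t → K x = 0) :
    ‖∫ x, (f x : ℂ) * K x‖ ≤
      M * ((1 + R) / (1 - ‖v‖)) ^ q * (∫ x, (1 + ‖x‖) ^ q * |f x|) * (1 + t) ^ (-q) := by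
  have hM0 : 0 ≤ M := (norm_nonneg _).trans (hM 0)
  have hv' : 0 < 1 - ‖v‖ := by linarith
  rw [mul_right_comm, ← integral_const_mul]
  have hf' : Integrable fun x => (1 + ‖x‖) ^ q * |f x| := by
    refine hf.abs.congr (Filter.Eventually.of_forall fun x => ?_)
    simp only [abs_mul]
    rw [abs_of_nonneg (by positivity)]
  refine norm_integral_le_of_norm_le (hf'.const_mul _) (Filter.Eventually.of_forall fun x => ?_)
  rw [norm_mul, Complex.norm_real, Real.norm_eq_abs]
  by_cases hx : ‖x + -(t • v)‖ + R < t
  · rw [hK x hx]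
    simp only [norm_zero, mul_zero]
    positivity
  · have h1 : ‖x + -(t • v)‖ ≤ ‖x‖ + t * ‖v‖ := by
      refine (norm_add_le _ _).trans ?_
      rw [norm_neg, norm_smul, Real.norm_eq_abs, abs_of_pos ht]
    -- Outside the cone `(1-|v|)t ≤ |x| + R`, hence `(1-|v|)(1+t) ≤ (1+R)(1+|x|)`.
    have h2 : 1 + t ≤ (1 + R) / (1 - ‖v‖) * (1 + ‖x‖) := by
      rw [div_mul_eq_mul_div, le_div_iff₀ hv']
      nlinarith [norm_nonneg x, norm_nonneg v, mul_nonneg hR (norm_nonneg x)]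
    have h3 : 1 ≤ ((1 + R) / (1 - ‖v‖)) ^ q * (1 + ‖x‖) ^ q * (1 + t) ^ (-q) := by
      rw [← Real.mul_rpow (by positivity) (by positivity), Real.rpow_neg (by positivity),
        ← div_eq_mul_inv, one_le_div (by positivity)]
      exact Real.rpow_le_rpow (by positivity) h2 hq
    calc |f x| * ‖K x‖ ≤ |f x| * M * 1 := by rw [mul_one]; gcongr; exact hM x
      _ ≤ |f x| * M * (((1 + R) / (1 - ‖v‖)) ^ q * (1 + ‖x‖) ^ q * (1 + t) ^ (-q)) := by gcongr
      _ = _ := by ring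

namespace IsChargeDistribution

variable {ρ : E3 → ℝ} (hρ : IsChargeDistribution ρ)
include hρ

lemma integrable_conj_fourierHat : Integrable fun k => conj (fourierHat ρ k) :=
  Complex.conjCLE.toContinuousLinearMap.integrable_comp hρ.integrable_fourierHat

lemma exists_norm_phiTime_le {v : E3} (hv : ‖v‖ < 1) {g f : E3 → ℝ} {q : ℝ} (hq : 0 ≤ q)
    (hgi : Integrable g) (hfi : Integrable f)
    (hg : Integrable fun x => (1 + ‖x‖) ^ q * g x) (hf : Integrable fun x => (1 + ‖x‖) ^ q * f x)
    (j : Fin 3) : ∃ C, ∀ t, 0 < t → ‖phiTime ρ v g f j t‖ ≤ C * (1 + t) ^ (-q) := by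
  obtain ⟨R, hR0, hR⟩ := hρ.exists_radius_integral_eq_zero
  have hm := hρ.integrable_conj_fourierHat
  set m : E3 → ℂ := fun k => conj (fourierHat ρ k) with hmdef
  set A := (∫ k, ‖m k‖) * ((1 + R) / (1 - ‖v‖)) ^ q
  refine ⟨‖fourierConst‖ * (A * ∫ x, (1 + ‖x‖) ^ q * |g x|) +
    ‖fourierConst‖ * (A * ∫ x, (1 + ‖x‖) ^ q * |f x|), fun t ht => ?_⟩
  have hcos1 : ∀ k : E3, ‖(Real.cos (‖k‖ * t) : ℂ)‖ ≤ 1 := fun k => by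
    rw [Complex.norm_real]; exact Real.abs_cos_le_one _
  have e1 := integral_planeWave_mul_fourierHat_mul hm hgi
    (q := fun k => (Real.cos (‖k‖ * t) : ℂ)) (by fun_prop) hcos1 (-(t • v))
  have e2 := integral_planeWave_mul_fourierHat_mul hm hfi
    (q := fun k => I * (k j : ℂ) * ((Real.sin (‖k‖ * t) / ‖k‖ : ℝ) : ℂ)) (by fun_prop)
    (fun k => norm_coord_mul_sin_div_le k j t) (-(t • v))
  have hbd : ∀ {h : E3 → ℝ} {b : E3 → ℂ}, Integrable h → Measurable b → (∀ k, ‖b k‖ ≤ 1) →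
      Integrable fun k => planeWave k (-(t • v)) * m k * (fourierHat h k * b k) := by
    intro h b hh hb hb1
    have hc := (WaveParticle.continuous_fourierHat hh).measurable
    refine (hm.norm.mul_const (‖fourierConst‖ * ∫ x, |h x|)).mono'
      (aestronglyMeasurable_planeWave_mul hm _ (by fun_prop))
      (Filter.Eventually.of_forall fun k => ?_)
    rw [norm_mul, norm_mul, norm_mul, norm_planeWave, one_mul]
    exact mul_le_mul_of_nonneg_left
      ((mul_le_of_le_one_right (norm_nonneg _) (hb1 k)).trans (norm_fourierHat_le h k))
      (norm_nonneg _)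
  have hsplit : phiTime ρ v g f j t =
      -(fourierConst * ∫ x, (g x : ℂ) * waveCos m t (x + -(t • v))) +
      fourierConst * ∫ x, (f x : ℂ) * waveSinPartial m j t (x + -(t • v)) := by
    simp only [waveCos, waveSinPartial]
    rw [← e1, ← e2, ← integral_neg, ← integral_add]
    · rw [phiTime]
      congr 1; ext k
      rw [timeFactor]; ring
    · exact (hbd hgi (by fun_prop) hcos1).neg
    · exact hbd hfi (by fun_prop) fun k => norm_coord_mul_sin_div_le k j t
  rw [hsplit, add_mul]
  refine (norm_add_le _ _).trans (add_le_add ?_ ?_)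
  · rw [norm_neg, norm_mul, mul_assoc]
    gcongr
    exact norm_integral_mul_le_of_light_cone hq hg (fun x => norm_waveCos_le hm t _) hv hR0 ht
      fun x hx => waveCos_eq_zero hm hR ht hx
  · rw [norm_mul, mul_assoc]
    gcongr
    exact norm_integral_mul_le_of_light_cone hq hf (fun x => norm_waveSinPartial_le hm j t _) hv
      hR0 ht fun x hx => waveSinPartial_eq_zero hm hR j ht hx

/-- The extra factor `t` costs one power, so `q > 2` is what leaves an exponent `1 - q < -1`. -/
lemma integrableOn_phiTime {v : E3} (hv : ‖v‖ < 1) {g f : E3 → ℝ} {q : ℝ} (hq : 2 < q)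
    (hgi : Integrable g) (hfi : Integrable f)
    (hg : Integrable fun x => (1 + ‖x‖) ^ q * g x) (hf : Integrable fun x => (1 + ‖x‖) ^ q * f x)
    (j : Fin 3) : IntegrableOn (phiTime ρ v g f j) (Set.Ioi 0) ∧
      IntegrableOn (fun t : ℝ => (t : ℂ) * phiTime ρ v g f j t) (Set.Ioi 0) := by
  obtain ⟨C, hC⟩ := hρ.exists_norm_phiTime_le hv (by linarith) hgi hfi hg hf j
  have hcont := hρ.continuous_phiTime v hgi hfi j
  have hC0 : 0 ≤ C := by
    have h1 := (norm_nonneg _).trans (hC 1 one_pos)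
    exact nonneg_of_mul_nonneg_left h1 (by positivity)
  have hdec : ∀ r : ℝ, r < -1 → IntegrableOn (fun t : ℝ => C * (1 + t) ^ r) (Set.Ioi 0) := by
    intro r hr
    have h : IntegrableOn (fun t : ℝ => (1 + t) ^ r) (Set.Ioi 0) := by
      simpa [add_comm] using integrableOn_add_rpow_Ioi_of_lt hr (c := (0 : ℝ)) (m := 1)
        (by norm_num)
    exact h.const_mul C
  constructor
  · refine (hdec (-q) (by linarith)).mono' hcont.aestronglyMeasurable
      ((ae_restrict_iff' measurableSet_Ioi).2 (Filter.Eventually.of_forall fun t ht => hC t ht))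
  · refine (hdec (1 - q) (by linarith)).mono' (Continuous.aestronglyMeasurable (by fun_prop))
      ((ae_restrict_iff' measurableSet_Ioi).2 (Filter.Eventually.of_forall fun t ht => ?_))
    have ht' : (0 : ℝ) < t := ht
    rw [norm_mul, Complex.norm_real, Real.norm_eq_abs, abs_of_pos ht', sub_eq_add_neg,
      Real.rpow_add (by positivity), Real.rpow_one]
    calc t * ‖phiTime ρ v g f j t‖ ≤ (1 + t) * (C * (1 + t) ^ (-q)) := by
          gcongr
          · linarith
          · exact hC t ht'
      _ = _ := by ring

end IsChargeDistribution

/-! ### The derivative of `Φ` at zero -/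

/-- The symbol `k² - (k·v)²`. -/
def symbolZero (v k : E3) : ℝ := ‖k‖ ^ 2 - ⟪k, v⟫_ℝ ^ 2

lemma abs_inner_le_norm_of_norm_le_one (k : E3) {v : E3} (hv : ‖v‖ ≤ 1) : |⟪k, v⟫_ℝ| ≤ ‖k‖ :=
  (abs_real_inner_le_norm k v).trans (mul_le_of_le_one_right (norm_nonneg _) hv)

lemma mul_sq_norm_le_symbolZero {v : E3} {r : ℝ} (hr : ‖v‖ ≤ r) (k : E3) :
    (1 - r ^ 2) * ‖k‖ ^ 2 ≤ symbolZero v k := by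
  have h1 : ⟪k, v⟫_ℝ ^ 2 ≤ (‖k‖ * r) ^ 2 := by
    refine sq_le_sq' ?_ ?_
    · exact (abs_le.1 ((abs_real_inner_le_norm k v).trans (by gcongr))).1
    · exact (abs_le.1 ((abs_real_inner_le_norm k v).trans (by gcongr))).2
  rw [symbolZero]
  nlinarith

lemma symbolZero_pos {v : E3} (hv : ‖v‖ < 1) {k : E3} (hk : k ≠ 0) : 0 < symbolZero v k := by
  refine lt_of_lt_of_le ?_ (mul_sq_norm_le_symbolZero le_rfl k)
  have h1 : 0 < ‖k‖ := norm_pos_iff.2 hk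
  have h2 : 0 < 1 - ‖v‖ ^ 2 := by nlinarith [norm_nonneg v]
  positivity

lemma symbolD_zero (v k : E3) : symbolD v 0 k = symbolZero v k := by
  simp only [symbolD, symbolZero]
  push_cast
  linear_combination ((⟪k, v⟫_ℝ : ℂ)) ^ 2 * I_sq

lemma symbolD_ofReal (v k : E3) (ε : ℝ) :
    symbolD v ε k = symbolZero v k + (2 * I * (⟪k, v⟫_ℝ : ℂ) + ε) * ε := by
  simp only [symbolD, symbolZero]
  push_cast
  linear_combination ((⟪k, v⟫_ℝ : ℂ)) ^ 2 * I_sq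

/-- For real `ε` the real part of `symbolD` is `symbolZero + ε²`. This lower bound makes dominated
convergence work along the real axis. -/
lemma symbolZero_le_norm_symbolD (v k : E3) (ε : ℝ) : symbolZero v k ≤ ‖symbolD v ε k‖ := by
  refine le_trans ?_ (Complex.re_le_norm _)
  rw [symbolD_ofReal]
  simp only [Complex.add_re, Complex.ofReal_re, Complex.mul_re, Complex.add_im, Complex.mul_im,
    Complex.ofReal_im, Complex.I_re, Complex.I_im, Complex.re_ofNat, Complex.im_ofNat]
  nlinarith [mul_self_nonneg ε]

/-- The integrand of the derivative of `Φ` at zero. -/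
def phiDerivIntegrand (ρ : E3 → ℝ) (v : E3) (psi0 pi0 : E3 → ℝ) (j : Fin 3) (k : E3) : ℂ :=
  (k j : ℂ) / (symbolZero v k : ℂ) ^ 2 *
    (((‖k‖ ^ 2 + ⟪k, v⟫_ℝ ^ 2 : ℝ) : ℂ) * fourierHat psi0 k -
      2 * I * (⟪k, v⟫_ℝ : ℂ) * fourierHat pi0 k) * conj (fourierHat ρ k)

/-- The difference quotient of the integrand of `Φ` at zero. -/
lemma phiIntegrand_sub_div (ρ : E3 → ℝ) {v : E3} (hv : ‖v‖ < 1) (Ψ f : E3 → ℝ) (j : Fin 3)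
    {k : E3} (hk : k ≠ 0) {ε : ℝ} (hε : ε ≠ 0) :
    (phiIntegrand ρ v Ψ f ε j k - phiIntegrand ρ v Ψ f 0 j k) / ε =
      (k j : ℂ) * (fourierHat Ψ k / symbolD v ε k -
        (I * (⟪k, v⟫_ℝ : ℂ) * fourierHat Ψ k + fourierHat f k) * (2 * I * (⟪k, v⟫_ℝ : ℂ) + ε) /
          (symbolD v ε k * symbolZero v k)) * conj (fourierHat ρ k) := by
  have h0 : (symbolZero v k : ℂ) ≠ 0 := Complex.ofReal_ne_zero.2 (symbolZero_pos hv hk).ne'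
  have h1 : symbolD v ε k ≠ 0 := norm_pos_iff.1
    ((symbolZero_pos hv hk).trans_le (symbolZero_le_norm_symbolD v k ε))
  have hε' : (ε : ℂ) ≠ 0 := Complex.ofReal_ne_zero.2 hε
  rw [phiIntegrand, phiIntegrand, symbolD_zero]
  field_simp
  -- The difference of the symbols at `ε` and at `0` has the factor `ε`, which cancels the
  -- denominator of the quotient.
  rw [symbolD_ofReal]
  ring

lemma measurable_phiIntegrand {ρ Ψ f : E3 → ℝ} (hρ : Integrable ρ) (hΨ : Integrable Ψ)
    (hf : Integrable f) (v : E3) (z : ℂ) (j : Fin 3) : Measurable (phiIntegrand ρ v Ψ f z j) := by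
  have h1 := (continuous_fourierHat hρ).measurable
  have h2 := (continuous_fourierHat hΨ).measurable
  have h3 := (continuous_fourierHat hf).measurable
  unfold phiIntegrand symbolD
  have h4 : Measurable fun k => conj (fourierHat ρ k) :=
    Complex.continuous_conj.measurable.comp h1
  fun_prop

namespace IsChargeDistribution

variable {ρ : E3 → ℝ} (hρ : IsChargeDistribution ρ)
include hρ

lemma integrable_phiIntegrand_zero {v : E3} (hv : ‖v‖ < 1) {Ψ f : E3 → ℝ} (hΨ : Integrable Ψ)
    (hf : Integrable f) (j : Fin 3) : Integrable (phiIntegrand ρ v Ψ f 0 j) := by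
  have hc : 0 < 1 - ‖v‖ ^ 2 := by nlinarith [norm_nonneg v]
  set c := 1 - ‖v‖ ^ 2
  set A := ‖fourierConst‖ * ∫ x, |Ψ x|
  set B := ‖fourierConst‖ * ∫ x, |f x|
  refine (((hρ.integrable_norm_fourierHat_div_pow (n := 0) (by norm_num)).const_mul (A / c)).add
    ((hρ.integrable_norm_fourierHat_div_pow (n := 1) (by norm_num)).const_mul (B / c))).mono'
    (measurable_phiIntegrand hρ.integrable hΨ hf v 0 j).aestronglyMeasurable
    (Filter.Eventually.of_forall fun k => ?_)
  rcases eq_or_ne k 0 with rfl | hk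
  · simp only [phiIntegrand, PiLp.zero_apply, Complex.ofReal_zero, zero_div, zero_mul, norm_zero,
      Pi.add_apply]
    positivity
  have hkp : 0 < ‖k‖ := norm_pos_iff.2 hk
  have hD := mul_sq_norm_le_symbolZero (v := v) le_rfl k
  have hDp := symbolZero_pos hv hk
  have hκ := abs_inner_le_norm_of_norm_le_one k hv.le
  rw [phiIntegrand, symbolD_zero, norm_mul, norm_mul, norm_div, RCLike.norm_conj,
    Complex.norm_real, Complex.norm_real, Real.norm_of_nonneg hDp.le, add_zero]
  have hnum : ‖I * (⟪k, v⟫_ℝ : ℂ) * fourierHat Ψ k + fourierHat f k‖ ≤ ‖k‖ * A + B := by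
    refine (norm_add_le _ _).trans (add_le_add ?_ (norm_fourierHat_le f k))
    rw [norm_mul, norm_mul, Complex.norm_I, one_mul, Complex.norm_real]
    exact mul_le_mul hκ (norm_fourierHat_le Ψ k) (norm_nonneg _) (norm_nonneg _)
  calc _ ≤ ‖k‖ / (c * ‖k‖ ^ 2) * (‖k‖ * A + B) * ‖fourierHat ρ k‖ := by
        gcongr
        exact PiLp.norm_apply_le k j
    _ = _ := by
        simp only [Pi.add_apply]
        field_simp

/-- Dominated convergence for `0 < ε ≤ 1`. The worst term of the quotient is of size
`|k|·|k|⁻⁴|ρ̂|`, which is why `ρ̂/|k|³` has to be integrable. -/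
lemma tendsto_Phi_slope {v : E3} (hv : ‖v‖ < 1) {Ψ f : E3 → ℝ} (hΨ : Integrable Ψ)
    (hf : Integrable f) (j : Fin 3)
    (hint : ∀ ε : ℝ, 0 < ε → Integrable (phiIntegrand ρ v Ψ f ε j)) :
    Filter.Tendsto (fun ε : ℝ => (Phi ρ v Ψ f ε j - Phi ρ v Ψ f 0 j) / ε)
      (nhdsWithin 0 (Set.Ioi 0)) (nhds (I * ∫ k, phiDerivIntegrand ρ v Ψ f j k)) := by
  have hc : 0 < 1 - ‖v‖ ^ 2 := by nlinarith [norm_nonneg v]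
  set c := 1 - ‖v‖ ^ 2
  set A := ‖fourierConst‖ * ∫ x, |Ψ x|
  set B := ‖fourierConst‖ * ∫ x, |f x|
  have hslope : ∀ ε : ℝ, ε ∈ Set.Ioi (0 : ℝ) →
      I * ∫ k, (phiIntegrand ρ v Ψ f ε j k - phiIntegrand ρ v Ψ f 0 j k) / ε =
      (Phi ρ v Ψ f ε j - Phi ρ v Ψ f 0 j) / ε := by
    intro ε hε
    rw [integral_div, integral_sub (hint ε hε) (hρ.integrable_phiIntegrand_zero hv hΨ hf j), Phi,
      Phi]
    ring
  refine Filter.Tendsto.congr' (Filter.eventually_of_mem self_mem_nhdsWithin hslope)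
    (Filter.Tendsto.const_mul I ?_)
  have hb := fun n (hn : n ≤ 3) => hρ.integrable_norm_fourierHat_div_pow (n := n) hn
  refine tendsto_integral_filter_of_dominated_convergence
    (fun k => (A / c + 2 * A / c ^ 2) * (‖fourierHat ρ k‖ / ‖k‖ ^ 1) +
      ((A + 2 * B) / c ^ 2 * (‖fourierHat ρ k‖ / ‖k‖ ^ 2) +
        B / c ^ 2 * (‖fourierHat ρ k‖ / ‖k‖ ^ 3))) ?_ ?_ ?_ ?_
  · exact Filter.Eventually.of_forall fun ε =>
      (((measurable_phiIntegrand hρ.integrable hΨ hf v ε j).sub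
        (measurable_phiIntegrand hρ.integrable hΨ hf v 0 j)).div_const _).aestronglyMeasurable
  · filter_upwards [Ioc_mem_nhdsGT one_pos] with ε hε
    filter_upwards [compl_mem_ae_iff.2 (measure_singleton (0 : E3))] with k hk
    have hkp : 0 < ‖k‖ := norm_pos_iff.2 hk
    have hD := mul_sq_norm_le_symbolZero (v := v) le_rfl k
    have hDε := hD.trans (symbolZero_le_norm_symbolD v k ε)
    have hDp := symbolZero_pos hv hk
    have hκ := abs_inner_le_norm_of_norm_le_one k hv.le
    rw [phiIntegrand_sub_div ρ hv Ψ f j hk hε.1.ne', norm_mul, norm_mul, RCLike.norm_conj,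
      Complex.norm_real]
    have hnum : ‖I * (⟪k, v⟫_ℝ : ℂ) * fourierHat Ψ k + fourierHat f k‖ ≤ ‖k‖ * A + B := by
      refine (norm_add_le _ _).trans (add_le_add ?_ (norm_fourierHat_le f k))
      rw [norm_mul, norm_mul, Complex.norm_I, one_mul, Complex.norm_real]
      exact mul_le_mul hκ (norm_fourierHat_le Ψ k) (norm_nonneg _) (norm_nonneg _)
    have hlin : ‖2 * I * (⟪k, v⟫_ℝ : ℂ) + (ε : ℂ)‖ ≤ 2 * ‖k‖ + 1 := by
      refine (norm_add_le _ _).trans (add_le_add ?_ ?_)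
      · rw [norm_mul, norm_mul, Complex.norm_I, mul_one, Complex.norm_real]
        simpa using hκ
      · rw [Complex.norm_real, Real.norm_of_nonneg hε.1.le]
        exact hε.2
    have hmid : ‖fourierHat Ψ k / symbolD v ε k -
        (I * (⟪k, v⟫_ℝ : ℂ) * fourierHat Ψ k + fourierHat f k) * (2 * I * (⟪k, v⟫_ℝ : ℂ) + ε) /
          (symbolD v ε k * symbolZero v k)‖ ≤ A / (c * ‖k‖ ^ 2) +
        (‖k‖ * A + B) * (2 * ‖k‖ + 1) / ((c * ‖k‖ ^ 2) * (c * ‖k‖ ^ 2)) := by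
      refine (norm_sub_le _ _).trans (add_le_add ?_ ?_)
      · rw [norm_div]
        gcongr
        exact norm_fourierHat_le Ψ k
      · rw [norm_div, norm_mul, norm_mul, Complex.norm_real, Real.norm_of_nonneg hDp.le]
        gcongr
    calc _ ≤ ‖k‖ * (A / (c * ‖k‖ ^ 2) +
        (‖k‖ * A + B) * (2 * ‖k‖ + 1) / ((c * ‖k‖ ^ 2) * (c * ‖k‖ ^ 2))) * ‖fourierHat ρ k‖ := by
          gcongr
          exact PiLp.norm_apply_le k j
      _ = _ := by
          field_simp
          ring
  · exact ((hb 1 (by norm_num)).const_mul _).add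
      (((hb 2 (by norm_num)).const_mul _).add ((hb 3 le_rfl).const_mul _))
  · filter_upwards [compl_mem_ae_iff.2 (measure_singleton (0 : E3))] with k hk
    have h0 : (symbolZero v k : ℂ) ≠ 0 := Complex.ofReal_ne_zero.2 (symbolZero_pos hv hk).ne'
    have hlim : Filter.Tendsto (fun ε : ℝ => (k j : ℂ) * (fourierHat Ψ k / symbolD v ε k -
        (I * (⟪k, v⟫_ℝ : ℂ) * fourierHat Ψ k + fourierHat f k) * (2 * I * (⟪k, v⟫_ℝ : ℂ) + ε) /
          (symbolD v ε k * symbolZero v k)) * conj (fourierHat ρ k)) (nhds 0)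
        (nhds (phiDerivIntegrand ρ v Ψ f j k)) := by
      have hDc : Continuous fun ε : ℝ => symbolD v ε k := by unfold symbolD; fun_prop
      have hD0 : symbolD v ((0 : ℝ) : ℂ) k ≠ 0 := by
        rw [Complex.ofReal_zero, symbolD_zero]; exact h0
      have hca : ContinuousAt (fun ε : ℝ => (k j : ℂ) * (fourierHat Ψ k / symbolD v ε k -
        (I * (⟪k, v⟫_ℝ : ℂ) * fourierHat Ψ k + fourierHat f k) * (2 * I * (⟪k, v⟫_ℝ : ℂ) + ε) /
          (symbolD v ε k * symbolZero v k)) * conj (fourierHat ρ k)) 0 := by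
        refine ((continuousAt_const.mul ((continuousAt_const.div hDc.continuousAt hD0).sub
          (ContinuousAt.div (Continuous.continuousAt (by fun_prop))
            (hDc.continuousAt.mul continuousAt_const) (mul_ne_zero hD0 h0)))).mul
          continuousAt_const)
      have hval := hca.tendsto
      convert hval using 2
      rw [Complex.ofReal_zero, symbolD_zero, phiDerivIntegrand]
      field_simp
      rw [symbolZero]
      push_cast
      ring_nf
      simp only [I_sq]
      ring
    refine (hlim.mono_left nhdsWithin_le_nhds).congr'
      (Filter.eventually_of_mem self_mem_nhdsWithin fun ε hε => ?_)
    exact (phiIntegrand_sub_div ρ hv Ψ f j hk (ne_of_gt hε)).symm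

/-- The Laplace representation gives existence of the derivative in the half-plane, and the real
one-sided limit gives its value. -/
lemma hasDerivWithinAt_Phi_apply {v : E3} (hv : ‖v‖ < 1) {Ψ g f : E3 → ℝ} {q : ℝ} (hq : 2 < q)
    {j : Fin 3} (hΨi : Integrable Ψ) (hgi : Integrable g) (hfi : Integrable f)
    (hg : Integrable fun x => (1 + ‖x‖) ^ q * g x) (hf : Integrable fun x => (1 + ‖x‖) ^ q * f x)
    (hΨ : ∀ k : E3, fourierHat g k = -(I * (k j : ℂ)) * fourierHat Ψ k) :
    HasDerivWithinAt (fun z => Phi ρ v Ψ f z j) (I * ∫ k, phiDerivIntegrand ρ v Ψ f j k)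
      laplaceDomain 0 := by
  obtain ⟨hF, htF⟩ := hρ.integrableOn_phiTime hv hq hgi hfi hg hf j
  have hL := hasDerivWithinAt_laplace hF htF
  set L : ℂ → ℂ := fun z => ∫ t : ℝ in Set.Ioi 0, cexp (-(z * t)) * phiTime ρ v g f j t with hLdef
  set L' := -∫ t : ℝ in Set.Ioi 0, (t : ℂ) * phiTime ρ v g f j t
  have hΦL : ∀ z : ℂ, 0 < z.re → Phi ρ v Ψ f z j = L z := fun z hz =>
    hρ.Phi_eq_laplace v hgi hfi hΨ hz
  have hΦε : ∀ ε : ℝ, 0 < ε → Phi ρ v Ψ f ε j = L ε := fun ε hε => hΦL ε (by simpa using hε)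
  have hslope := hρ.tendsto_Phi_slope hv hΨi hfi j fun ε hε =>
    hρ.integrable_phiIntegrand_of_re_pos v hgi hfi hΨ (z := ε) (by simpa using hε)
  have hof : Filter.Tendsto (fun ε : ℝ => (ε : ℂ)) (nhdsWithin 0 (Set.Ioi 0))
      (nhdsWithin 0 ({z : ℂ | 0 ≤ z.re} \ {0})) := by
    refine tendsto_nhdsWithin_iff.2 ⟨?_, ?_⟩
    · exact (Complex.continuous_ofReal.tendsto' 0 0 (by simp)).mono_left nhdsWithin_le_nhds
    · refine Filter.eventually_of_mem self_mem_nhdsWithin fun ε hε => ?_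
      have hε' : (0 : ℝ) < ε := hε
      exact ⟨by simpa using hε'.le, by simpa using hε'.ne'⟩
  have hε0 : Filter.Tendsto (fun ε : ℝ => (ε : ℂ)) (nhdsWithin 0 (Set.Ioi 0)) (nhds 0) :=
    hof.mono_right nhdsWithin_le_nhds
  -- The representation is proved only for `Re z > 0`. It extends to `0` because both sides are
  -- continuous along the positive reals, `Phi` by convergence of its difference quotient.
  have hzero : Phi ρ v Ψ f 0 j = L 0 := by
    have h1 : Filter.Tendsto (fun ε : ℝ => Phi ρ v Ψ f ε j) (nhdsWithin 0 (Set.Ioi 0))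
        (nhds (Phi ρ v Ψ f 0 j)) := by
      have := (hslope.mul hε0).add_const (Phi ρ v Ψ f 0 j)
      rw [mul_zero, zero_add] at this
      refine this.congr' (Filter.eventually_of_mem self_mem_nhdsWithin fun ε hε => ?_)
      have hε' : (ε : ℂ) ≠ 0 := Complex.ofReal_ne_zero.2 (ne_of_gt hε)
      simp only [div_mul_cancel₀ _ hε', sub_add_cancel]
    have h2 : Filter.Tendsto (fun ε : ℝ => L ε) (nhdsWithin 0 (Set.Ioi 0)) (nhds (L 0)) :=
      hL.continuousWithinAt.tendsto.comp
        (hof.mono_right (nhdsWithin_mono 0 Set.sdiff_subset))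
    exact tendsto_nhds_unique h1 (h2.congr'
      (Filter.eventually_of_mem self_mem_nhdsWithin fun ε hε => (hΦε ε hε).symm))
  have hL' : L' = I * ∫ k, phiDerivIntegrand ρ v Ψ f j k := by
    refine tendsto_nhds_unique ((hasDerivWithinAt_iff_tendsto_slope.1 hL).comp hof)
      (hslope.congr' (Filter.eventually_of_mem self_mem_nhdsWithin fun ε hε => ?_))
    rw [Function.comp_apply, slope_def_field, hΦε ε hε, hzero, sub_zero]
  rw [← hL']
  refine (hL.mono ?_).congr ?_ hzero
  · rintro z (rfl | hz)
    · simp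
    · exact (show 0 < z.re from hz).le
  · rintro z (rfl | hz)
    · exact hzero
    · exact hΦL z hz

end IsChargeDistribution

/-- A convex set with nonempty interior has unique derivatives at its closure points; this makes
`derivWithin` agree with the derivative found. -/
lemma uniqueDiffWithinAt_laplaceDomain : UniqueDiffWithinAt ℂ laplaceDomain 0 := by
  have hsub : {z : ℂ | 0 < z.re} ⊆ laplaceDomain := Set.subset_insert _ _
  refine UniqueDiffWithinAt.mono ?_ hsub
  refine uniqueDiffWithinAt_convex_of_isRCLikeNormedField (convex_halfSpace_re_gt 0) ?_ ?_
  · rw [(isOpen_lt continuous_const Complex.continuous_re).interior_eq]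
    exact ⟨1, by simp⟩
  · refine mem_closure_of_tendsto (f := fun n : ℕ => ((1 / ((n : ℝ) + 1) : ℝ) : ℂ))
      (b := Filter.atTop) ?_ (Filter.Eventually.of_forall fun n => ?_)
    · exact (Complex.continuous_ofReal.tendsto' 0 0 (by simp)).comp
        tendsto_one_div_add_atTop_nhds_zero_nat
    · change 0 < ((1 / ((n : ℝ) + 1) : ℝ) : ℂ).re
      rw [Complex.ofReal_re]
      positivity

/-! ### Fields given by their Fourier transform -/

/-- The real part of the inverse Fourier transform `(2π)^{-3/2} ∫ e^{-i k·x} g(k) dk`. -/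
def invTransform (g : E3 → ℂ) (x : E3) : ℝ :=
  (fourierConst * ∫ k, planeWave k (-x) * g k).re

lemma continuous_invTransform {g : E3 → ℂ} (hg : Integrable g) : Continuous (invTransform g) := by
  refine Complex.continuous_re.comp (continuous_const.mul
    (continuous_of_dominated (bound := fun k => ‖g k‖) (fun x => ?_) (fun x => ?_) hg.norm ?_))
  · exact (Continuous.aestronglyMeasurable (by fun_prop)).mul hg.aestronglyMeasurable
  · exact Filter.Eventually.of_forall fun k => by simp
  · exact Filter.Eventually.of_forall fun k => by fun_prop

lemma norm_invTransform_le {g : E3 → ℂ} (hg : Integrable g) (x : E3) :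
    ‖invTransform g x‖ ≤ ‖fourierConst‖ * ∫ k, ‖g k‖ := by
  refine (Complex.abs_re_le_norm _).trans ?_
  rw [norm_mul]
  gcongr
  exact norm_integral_le_of_norm_le hg.norm (Filter.Eventually.of_forall fun k => by simp)

lemma invTransform_neg (g : E3 → ℂ) (x : E3) :
    invTransform (fun k => -g k) x = -invTransform g x := by
  simp [invTransform, integral_neg]

lemma integrable_mul_invTransform {f : E3 → ℝ} (hf : Integrable f) {g : E3 → ℂ}
    (hg : Integrable g) : Integrable fun x => f x * invTransform g x :=
  hf.mul_bdd (continuous_invTransform hg).aestronglyMeasurable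
    (Filter.Eventually.of_forall (norm_invTransform_le hg))

/-- Parseval in the `L¹`–`L¹` setting is just Fubini. The real part on the right matches the one in
`invTransform`. -/
lemma integral_mul_invTransform {f : E3 → ℝ} (hf : Integrable f) {g : E3 → ℂ}
    (hg : Integrable g) :
    ∫ x, f x * invTransform g x = (∫ k, fourierHat f k * conj (g k)).re := by
  have hint : Integrable (fun p : E3 × E3 => (f p.1 : ℂ) * g p.2) (volume.prod volume) :=
    (hf.ofReal (𝕜 := ℂ)).mul_prod hg
  have hint' : Integrable (Function.uncurry fun x k : E3 =>
      planeWave k (-x) * ((f x : ℂ) * g k)) (volume.prod volume) :=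
    hint.bdd_mul (c := 1) (f := fun p : E3 × E3 => planeWave p.2 (-p.1))
      (Continuous.aestronglyMeasurable (by fun_prop)) (by simp)
  have hswap := integral_integral_swap hint'
  have h1 : ∀ x, f x * invTransform g x =
      (fourierConst * ∫ k, planeWave k (-x) * ((f x : ℂ) * g k)).re := fun x => by
    rw [invTransform, ← Complex.re_ofReal_mul]
    congr 1
    rw [mul_left_comm, ← integral_const_mul]
    congr 2; ext k; ring
  have h2 : (∫ x, fourierConst * ∫ k, planeWave k (-x) * ((f x : ℂ) * g k)) =
      conj (∫ k, fourierHat f k * conj (g k)) := by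
    rw [integral_const_mul, hswap, ← integral_conj, ← integral_const_mul]
    congr 1; ext k
    rw [map_mul, Complex.conj_conj, fourierHat_eq, map_mul, conj_fourierConst, ← integral_conj,
      mul_assoc, ← integral_mul_const]
    congr 2; ext x
    rw [planeWave_neg_right, map_mul, Complex.conj_ofReal]
    ring
  have h3 := hint'.integral_prod_left.const_mul fourierConst
  simp only [h1]
  have h4 := Complex.reCLM.integral_comp_comm h3
  simp only [Complex.reCLM_apply, Function.uncurry] at h4
  rw [h4, h2, Complex.conj_re]

/-- Common source of the derivatives in `x` (parameter in the phase) and in `v` (parameter in the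
symbol). The point `k = 0`, where the symbols degenerate, is excluded as a null set. -/
lemma hasDerivAt_invTransform_param {G G' : ℝ → E3 → ℂ} {bound : E3 → ℝ} {η : ℝ} (hη : 0 < η)
    (hG : ∀ s, Measurable (G s)) (hG0 : Integrable (G 0)) (hG' : Measurable (G' 0))
    (hb : ∀ k ≠ 0, ∀ s ∈ Metric.ball (0 : ℝ) η, ‖G' s k‖ ≤ bound k) (hbi : Integrable bound)
    (hd : ∀ k ≠ 0, ∀ s ∈ Metric.ball (0 : ℝ) η, HasDerivAt (fun s => G s k) (G' s k) s)
    (x : E3) :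
    HasDerivAt (fun s => invTransform (G s) x) (invTransform (G' 0) x) 0 := by
  have hpw : Measurable fun k => planeWave k (-x) := Continuous.measurable (by fun_prop)
  have h := (hasDerivAt_integral_of_dominated_loc_of_deriv_le (x₀ := (0 : ℝ)) (μ := volume)
    (F := fun s k => planeWave k (-x) * G s k) (F' := fun s k => planeWave k (-x) * G' s k)
    (bound := bound) (Metric.ball_mem_nhds 0 hη)
    (Filter.Eventually.of_forall fun s => (hpw.mul (hG s)).aestronglyMeasurable)
    (hG0.bdd_mul (c := 1) hpw.aestronglyMeasurable (by simp))
    (hpw.mul hG').aestronglyMeasurable ?_ hbi ?_).2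
  · exact Complex.reCLM.hasFDerivAt.comp_hasDerivAt (0 : ℝ) (h.const_mul fourierConst)
  · filter_upwards [compl_mem_ae_iff.2 (measure_singleton (0 : E3))] with k hk s hs
    rw [norm_mul, norm_planeWave, one_mul]
    exact hb k hk s hs
  · filter_upwards [compl_mem_ae_iff.2 (measure_singleton (0 : E3))] with k hk s hs
    exact (hd k hk s hs).const_mul _

lemma hasDerivAt_invTransform_line {g : E3 → ℂ} (hgm : Measurable g) (hg : Integrable g)
    (hkg : Integrable fun k => ‖k‖ * ‖g k‖) (x w : E3) :
    HasDerivAt (fun s : ℝ => invTransform g (x + s • w))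
      (invTransform (fun k => -(I * (⟪k, w⟫_ℝ : ℂ) * g k)) x) 0 := by
  have h := hasDerivAt_invTransform_param (η := 1) one_pos
    (G := fun s k => planeWave k (s • -w) * g k)
    (G' := fun s k => -(I * (⟪k, w⟫_ℝ : ℂ) * (planeWave k (s • -w) * g k)))
    (bound := fun k => ‖w‖ * (‖k‖ * ‖g k‖)) ?_ ?_ ?_ ?_ (hkg.const_mul _) ?_ x
  · simp only [zero_smul] at h
    have h0 : ∀ k, planeWave k 0 = 1 := fun k => by simp [planeWave]
    simp only [h0, one_mul] at h
    refine h.congr_of_eventuallyEq (Filter.Eventually.of_forall fun s => ?_)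
    simp only [invTransform]
    congr 3; ext k
    rw [← mul_assoc, ← planeWave_add_right, neg_add, smul_neg]
  · exact fun s => (Continuous.measurable (by fun_prop)).mul hgm
  · exact hg.bdd_mul (c := 1) (Continuous.aestronglyMeasurable (by fun_prop)) (by simp)
  · exact (Measurable.mul (Continuous.measurable (by fun_prop))
      ((Continuous.measurable (by fun_prop)).mul hgm)).neg
  · intro k _ s _
    rw [norm_neg, norm_mul, norm_mul, norm_mul, norm_planeWave, Complex.norm_I, one_mul, one_mul,
      Complex.norm_real, ← mul_assoc, mul_comm ‖w‖]
    gcongr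
    exact norm_inner_le_norm k w
  · intro k _ s _
    have h1 := hasDerivAt_planeWave_right k 0 (-w) s
    simp only [zero_add] at h1
    refine (h1.mul_const (g k)).congr_deriv ?_
    rw [inner_neg_right]
    push_cast
    ring

/-! ### The soliton fields -/

/-- The Fourier transform of the soliton field `ψ_v`. -/
def psiHat (ρ : E3 → ℝ) (v k : E3) : ℂ := -fourierHat ρ k / (symbolZero v k : ℂ)

/-- The Fourier transform of the soliton field `π_v`. -/
def piHat (ρ : E3 → ℝ) (v k : E3) : ℂ := I * (⟪k, v⟫_ℝ : ℂ) * psiHat ρ v k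

/-- The derivative of `psiHat` with respect to `v_j`. -/
def psiHatDeriv (ρ : E3 → ℝ) (j : Fin 3) (v k : E3) : ℂ :=
  -(2 * (⟪k, v⟫_ℝ : ℂ) * (k j : ℂ) * fourierHat ρ k) / (symbolZero v k : ℂ) ^ 2

/-- The derivative of `piHat` with respect to `v_j`. -/
def piHatDeriv (ρ : E3 → ℝ) (j : Fin 3) (v k : E3) : ℂ :=
  I * ((k j : ℂ) * psiHat ρ v k + (⟪k, v⟫_ℝ : ℂ) * psiHatDeriv ρ j v k)

lemma solitonPsi_eq (ρ : E3 → ℝ) (v : E3) : solitonPsi ρ v = invTransform (psiHat ρ v) := by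
  ext x
  simp [solitonPsi, invTransform, planeWave, psiHat, symbolZero]

lemma hasDerivAt_inner_line (k v : E3) (j : Fin 3) (s : ℝ) :
    HasDerivAt (fun s : ℝ => ⟪k, v + s • basisVec j⟫_ℝ) (k j) s := by
  simp only [inner_add_right, real_inner_smul_right, inner_basisVec]
  simpa using ((hasDerivAt_id s).mul_const (k j)).const_add ⟪k, v⟫_ℝ

lemma hasDerivAt_psiHat (ρ : E3 → ℝ) {v k : E3} (j : Fin 3) {s : ℝ}
    (h0 : symbolZero (v + s • basisVec j) k ≠ 0) :
    HasDerivAt (fun s : ℝ => psiHat ρ (v + s • basisVec j) k)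
      (psiHatDeriv ρ j (v + s • basisVec j) k) s := by
  have h1 := hasDerivAt_inner_line k v j s
  have h2 : HasDerivAt (fun s : ℝ => symbolZero (v + s • basisVec j) k)
      (-(2 * ⟪k, v + s • basisVec j⟫_ℝ * k j)) s := by
    unfold symbolZero
    simpa using (h1.fun_pow 2).const_sub (‖k‖ ^ 2)
  have h3 := (hasDerivAt_const s (-fourierHat ρ k)).fun_div h2.ofReal_comp
    (Complex.ofReal_ne_zero.2 h0)
  refine h3.congr_deriv ?_
  rw [psiHatDeriv]
  push_cast
  ring

lemma hasDerivAt_piHat (ρ : E3 → ℝ) {v k : E3} (j : Fin 3) {s : ℝ}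
    (h0 : symbolZero (v + s • basisVec j) k ≠ 0) :
    HasDerivAt (fun s : ℝ => piHat ρ (v + s • basisVec j) k)
      (piHatDeriv ρ j (v + s • basisVec j) k) s := by
  have h := ((hasDerivAt_inner_line k v j s).ofReal_comp.const_mul I).fun_mul
    (hasDerivAt_psiHat ρ j h0)
  refine h.congr_deriv ?_
  rw [piHatDeriv]
  ring

/-- The bound depends on `v` only through a radius `r < 1`; in the analogous bounds for the
`v`-derivatives this uniformity supplies the majorant for differentiating in `v`. -/
lemma norm_psiHat_le (ρ : E3 → ℝ) {v k : E3} {r : ℝ} (hvr : ‖v‖ ≤ r) (hr : r < 1) :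
    ‖psiHat ρ v k‖ ≤ (1 - r ^ 2)⁻¹ * (‖fourierHat ρ k‖ / ‖k‖ ^ 2) := by
  rcases eq_or_ne k 0 with rfl | hk
  · simp [psiHat, symbolZero]
  have hr0 : 0 ≤ r := (norm_nonneg v).trans hvr
  have hc : 0 < 1 - r ^ 2 := by nlinarith
  have hkp : 0 < ‖k‖ := norm_pos_iff.2 hk
  have hS := mul_sq_norm_le_symbolZero hvr k
  rw [psiHat, norm_div, norm_neg, Complex.norm_real,
    Real.norm_of_nonneg (symbolZero_pos (hvr.trans_lt hr) hk).le]
  calc _ ≤ ‖fourierHat ρ k‖ / ((1 - r ^ 2) * ‖k‖ ^ 2) := by gcongr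
    _ = _ := by field_simp

lemma norm_psiHatDeriv_le (ρ : E3 → ℝ) (j : Fin 3) {v k : E3} {r : ℝ} (hvr : ‖v‖ ≤ r)
    (hr : r < 1) :
    ‖psiHatDeriv ρ j v k‖ ≤ 2 * (1 - r ^ 2)⁻¹ ^ 2 * (‖fourierHat ρ k‖ / ‖k‖ ^ 2) := by
  rcases eq_or_ne k 0 with rfl | hk
  · simp [psiHatDeriv, symbolZero]
  have hr0 : 0 ≤ r := (norm_nonneg v).trans hvr
  have hc : 0 < 1 - r ^ 2 := by nlinarith
  have hkp : 0 < ‖k‖ := norm_pos_iff.2 hk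
  have hS := mul_sq_norm_le_symbolZero hvr k
  have hκ := abs_inner_le_norm_of_norm_le_one k (hvr.trans hr.le)
  rw [psiHatDeriv, norm_div, norm_neg, norm_mul, norm_mul, norm_mul, norm_pow, Complex.norm_real,
    Complex.norm_real, Complex.norm_real,
    Real.norm_of_nonneg (symbolZero_pos (hvr.trans_lt hr) hk).le, Real.norm_eq_abs ⟪k, v⟫_ℝ,
    RCLike.norm_ofNat]
  calc _ ≤ 2 * ‖k‖ * ‖k‖ * ‖fourierHat ρ k‖ / ((1 - r ^ 2) * ‖k‖ ^ 2) ^ 2 := by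
        gcongr
        exact PiLp.norm_apply_le k j
    _ = _ := by field_simp

lemma norm_piHatDeriv_le (ρ : E3 → ℝ) (j : Fin 3) {v k : E3} {r : ℝ} (hvr : ‖v‖ ≤ r)
    (hr : r < 1) :
    ‖piHatDeriv ρ j v k‖ ≤
      ((1 - r ^ 2)⁻¹ + 2 * (1 - r ^ 2)⁻¹ ^ 2) * (‖fourierHat ρ k‖ / ‖k‖ ^ 1) := by
  rcases eq_or_ne k 0 with rfl | hk
  · simp [piHatDeriv]
  have hkp : 0 < ‖k‖ := norm_pos_iff.2 hk
  have hκ := abs_inner_le_norm_of_norm_le_one k (hvr.trans hr.le)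
  rw [piHatDeriv, norm_mul, Complex.norm_I, one_mul]
  calc _ ≤ ‖k‖ * ((1 - r ^ 2)⁻¹ * (‖fourierHat ρ k‖ / ‖k‖ ^ 2)) +
        ‖k‖ * (2 * (1 - r ^ 2)⁻¹ ^ 2 * (‖fourierHat ρ k‖ / ‖k‖ ^ 2)) := by
        refine (norm_add_le _ _).trans (add_le_add ?_ ?_)
        · rw [norm_mul, Complex.norm_real]
          exact mul_le_mul (PiLp.norm_apply_le k j) (norm_psiHat_le ρ hvr hr) (norm_nonneg _)
            (norm_nonneg _)
        · rw [norm_mul, Complex.norm_real]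
          exact mul_le_mul hκ (norm_psiHatDeriv_le ρ j hvr hr) (norm_nonneg _) (norm_nonneg _)
    _ = _ := by field_simp

lemma norm_piHat_le (ρ : E3 → ℝ) {v : E3} (hv : ‖v‖ < 1) (k : E3) :
    ‖piHat ρ v k‖ ≤ ‖k‖ * ‖psiHat ρ v k‖ := by
  rw [piHat, norm_mul, norm_mul, Complex.norm_I, one_mul, Complex.norm_real]
  gcongr
  exact abs_inner_le_norm_of_norm_le_one k hv.le

lemma integrable_coord_mul {g : E3 → ℂ} (hgm : Measurable g)
    (hkg : Integrable fun k => ‖k‖ * ‖g k‖) (j : Fin 3) :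
    Integrable fun k => I * (k j : ℂ) * g k := by
  refine hkg.mono' (Measurable.aestronglyMeasurable (by fun_prop))
    (Filter.Eventually.of_forall fun k => ?_)
  rw [norm_mul, norm_mul, Complex.norm_I, one_mul, Complex.norm_real]
  gcongr
  exact PiLp.norm_apply_le k j

namespace IsChargeDistribution

variable {ρ : E3 → ℝ} (hρ : IsChargeDistribution ρ)
include hρ

lemma measurable_psiHat (v : E3) : Measurable (psiHat ρ v) := by
  have h1 := hρ.continuous_fourierHat.measurable
  unfold psiHat symbolZero
  fun_prop

lemma measurable_piHat (v : E3) : Measurable (piHat ρ v) := by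
  have h1 := hρ.measurable_psiHat v
  unfold piHat
  fun_prop

lemma measurable_psiHatDeriv (j : Fin 3) (v : E3) : Measurable (psiHatDeriv ρ j v) := by
  have h1 := hρ.continuous_fourierHat.measurable
  unfold psiHatDeriv symbolZero
  fun_prop

lemma measurable_piHatDeriv (j : Fin 3) (v : E3) : Measurable (piHatDeriv ρ j v) := by
  have h1 := hρ.measurable_psiHat v
  have h2 := hρ.measurable_psiHatDeriv j v
  unfold piHatDeriv
  fun_prop

lemma integrable_pow_norm_mul_psiHat {v : E3} (hv : ‖v‖ < 1) {n : ℕ} (hn : n ≤ 2) :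
    Integrable fun k => ‖k‖ ^ n * ‖psiHat ρ v k‖ := by
  refine ((hρ.integrable_norm_fourierHat_div_pow (n := 2 - n) (by omega)).const_mul
    (1 - ‖v‖ ^ 2)⁻¹).mono' ?_ (Filter.Eventually.of_forall fun k => ?_)
  · exact ((continuous_norm.pow n).measurable.mul
      (hρ.measurable_psiHat v).norm).aestronglyMeasurable
  · rw [norm_mul, norm_pow, norm_norm, norm_norm]
    rcases eq_or_ne k 0 with rfl | hk
    · simp [psiHat, hρ.fourierHat_zero]
    have hkp : 0 < ‖k‖ := norm_pos_iff.2 hk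
    calc _ ≤ ‖k‖ ^ n * ((1 - ‖v‖ ^ 2)⁻¹ * (‖fourierHat ρ k‖ / ‖k‖ ^ 2)) := by
          gcongr
          exact norm_psiHat_le ρ le_rfl hv
      _ = _ := by
          have h2 : ‖k‖ ^ 2 = ‖k‖ ^ (2 - n) * ‖k‖ ^ n := by rw [← pow_add, Nat.sub_add_cancel hn]
          rw [h2]
          field_simp

lemma integrable_psiHat {v : E3} (hv : ‖v‖ < 1) : Integrable (psiHat ρ v) := by
  refine (hρ.integrable_pow_norm_mul_psiHat hv (n := 0) (by norm_num)).mono'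
    (hρ.measurable_psiHat v).aestronglyMeasurable (Filter.Eventually.of_forall fun k => by simp)

lemma integrable_piHat {v : E3} (hv : ‖v‖ < 1) : Integrable (piHat ρ v) := by
  refine (hρ.integrable_pow_norm_mul_psiHat hv (n := 1) (by norm_num)).mono'
    (hρ.measurable_piHat v).aestronglyMeasurable (Filter.Eventually.of_forall fun k => ?_)
  rw [pow_one]
  exact norm_piHat_le ρ hv k

lemma integrable_norm_mul_piHat {v : E3} (hv : ‖v‖ < 1) :
    Integrable fun k => ‖k‖ * ‖piHat ρ v k‖ := by
  refine (hρ.integrable_pow_norm_mul_psiHat hv (n := 2) le_rfl).mono'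
    (continuous_norm.measurable.mul (hρ.measurable_piHat v).norm).aestronglyMeasurable
    (Filter.Eventually.of_forall fun k => ?_)
  rw [norm_mul, norm_norm, norm_norm, pow_two, mul_assoc]
  gcongr
  exact norm_piHat_le ρ hv k

lemma integrable_psiHatDeriv {v : E3} (hv : ‖v‖ < 1) (j : Fin 3) :
    Integrable (psiHatDeriv ρ j v) :=
  ((hρ.integrable_norm_fourierHat_div_pow (n := 2) (by norm_num)).const_mul _).mono'
    (hρ.measurable_psiHatDeriv j v).aestronglyMeasurable
    (Filter.Eventually.of_forall fun _ => norm_psiHatDeriv_le ρ j le_rfl hv)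

lemma integrable_piHatDeriv {v : E3} (hv : ‖v‖ < 1) (j : Fin 3) :
    Integrable (piHatDeriv ρ j v) :=
  ((hρ.integrable_norm_fourierHat_div_pow (n := 1) (by norm_num)).const_mul _).mono'
    (hρ.measurable_piHatDeriv j v).aestronglyMeasurable
    (Filter.Eventually.of_forall fun _ => norm_piHatDeriv_le ρ j le_rfl hv)

lemma solitonPi_eq {v : E3} (hv : ‖v‖ < 1) : solitonPi ρ v = invTransform (piHat ρ v) := by
  ext x
  have h := hasDerivAt_invTransform_line (hρ.measurable_psiHat v) (hρ.integrable_psiHat hv)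
    (by simpa using hρ.integrable_pow_norm_mul_psiHat hv (n := 1) (by norm_num)) x v
  rw [solitonPi, solitonPsi_eq, lineDeriv, h.deriv, invTransform_neg, neg_neg]
  rfl

lemma partialD_solitonPsi {v : E3} (hv : ‖v‖ < 1) (j : Fin 3) (x : E3) :
    -partialD j (solitonPsi ρ v) x = invTransform (fun k => I * (k j : ℂ) * psiHat ρ v k) x := by
  have h := hasDerivAt_invTransform_line (hρ.measurable_psiHat v) (hρ.integrable_psiHat hv)
    (by simpa using hρ.integrable_pow_norm_mul_psiHat hv (n := 1) (by norm_num)) x (basisVec j)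
  rw [solitonPsi_eq, partialD_eq_of_hasDerivAt h, invTransform_neg, neg_neg]
  simp only [inner_basisVec]

lemma partialD_solitonPi {v : E3} (hv : ‖v‖ < 1) (j : Fin 3) (x : E3) :
    -partialD j (solitonPi ρ v) x = invTransform (fun k => I * (k j : ℂ) * piHat ρ v k) x := by
  have h := hasDerivAt_invTransform_line (hρ.measurable_piHat v) (hρ.integrable_piHat hv)
    (hρ.integrable_norm_mul_piHat hv) x (basisVec j)
  rw [hρ.solitonPi_eq hv, partialD_eq_of_hasDerivAt h, invTransform_neg, neg_neg]
  simp only [inner_basisVec]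

end IsChargeDistribution

/-! ### Velocity derivatives of the soliton fields -/

lemma norm_add_smul_basisVec_le (v : E3) (j : Fin 3) {s η : ℝ} (hs : s ∈ Metric.ball (0 : ℝ) η) :
    ‖v + s • basisVec j‖ ≤ ‖v‖ + η := by
  refine (norm_add_le _ _).trans ?_
  have h1 : |s| < η := by simpa using hs
  rw [norm_smul, Real.norm_eq_abs]
  simpa [basisVec] using h1.le

namespace IsChargeDistribution

variable {ρ : E3 → ℝ} (hρ : IsChargeDistribution ρ)
include hρ

lemma partialD_velocity_solitonPsi {v : E3} (hv : ‖v‖ < 1) (j : Fin 3) (x : E3) :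
    partialD j (fun w => solitonPsi ρ w x) v = invTransform (psiHatDeriv ρ j v) x := by
  -- Half the distance to the unit sphere: every velocity `v + s e_j` with `|s| < η` stays in a
  -- fixed ball of radius less than one.
  have hη : 0 < (1 - ‖v‖) / 2 := by linarith
  have hr : ‖v‖ + (1 - ‖v‖) / 2 < 1 := by linarith
  have h := hasDerivAt_invTransform_param hη
    (G := fun s => psiHat ρ (v + s • basisVec j))
    (G' := fun s => psiHatDeriv ρ j (v + s • basisVec j))
    (fun s => hρ.measurable_psiHat _) (by simpa using hρ.integrable_psiHat hv)
    (hρ.measurable_psiHatDeriv j _)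
    (fun k _ s hs => norm_psiHatDeriv_le ρ j (norm_add_smul_basisVec_le v j hs) hr)
    ((hρ.integrable_norm_fourierHat_div_pow (n := 2) (by norm_num)).const_mul _)
    (fun k hk s hs => hasDerivAt_psiHat ρ j
      (symbolZero_pos ((norm_add_smul_basisVec_le v j hs).trans_lt hr) hk).ne') x
  simp only [solitonPsi_eq]
  rw [partialD_eq_of_hasDerivAt (f := fun w => invTransform (psiHat ρ w) x) h]
  simp

lemma partialD_velocity_solitonPi {v : E3} (hv : ‖v‖ < 1) (j : Fin 3) (x : E3) :
    partialD j (fun w => solitonPi ρ w x) v = invTransform (piHatDeriv ρ j v) x := by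
  have hη : 0 < (1 - ‖v‖) / 2 := by linarith
  have hr : ‖v‖ + (1 - ‖v‖) / 2 < 1 := by linarith
  have h := hasDerivAt_invTransform_param hη
    (G := fun s => piHat ρ (v + s • basisVec j))
    (G' := fun s => piHatDeriv ρ j (v + s • basisVec j))
    (fun s => hρ.measurable_piHat _) (by simpa using hρ.integrable_piHat hv)
    (hρ.measurable_piHatDeriv j _)
    (fun k _ s hs => norm_piHatDeriv_le ρ j (norm_add_smul_basisVec_le v j hs) hr)
    ((hρ.integrable_norm_fourierHat_div_pow (n := 1) (by norm_num)).const_mul _)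
    (fun k hk s hs => hasDerivAt_piHat ρ j
      (symbolZero_pos ((norm_add_smul_basisVec_le v j hs).trans_lt hr) hk).ne') x
  have h' : HasDerivAt (fun s : ℝ => solitonPi ρ (v + s • basisVec j) x)
      (invTransform (piHatDeriv ρ j (v + (0 : ℝ) • basisVec j)) x) 0 := by
    -- The Fourier formula for `solitonPi` is available only for speeds below one, hence only for
    -- small `s`.
    refine h.congr_of_eventuallyEq ?_
    filter_upwards [Metric.ball_mem_nhds (0 : ℝ) hη] with s hs
    rw [hρ.solitonPi_eq ((norm_add_smul_basisVec_le v j hs).trans_lt hr)]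
  have h2 := partialD_eq_of_hasDerivAt (f := fun w => solitonPi ρ w x) h'
  rw [h2]
  simp

end IsChargeDistribution

/-! ### The symplectic products with the tangent vectors -/

/-- Substituting `-k` for `k` shows that the integral equals its conjugate. It serves to remove the
real parts introduced by `invTransform`. -/
lemma integral_im_eq_zero {F : E3 → ℂ} (hF : ∀ k, F (-k) = conj (F k)) : (∫ k, F k).im = 0 := by
  rw [← Complex.conj_eq_iff_im, ← integral_conj]
  simp only [← hF]
  exact integral_neg_eq_self F volume

lemma symbolZero_neg (v k : E3) : symbolZero v (-k) = symbolZero v k := by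
  simp [symbolZero]

lemma Phi_zero_im (ρ : E3 → ℝ) (v : E3) (Ψ f : E3 → ℝ) (j : Fin 3) :
    (Phi ρ v Ψ f 0 j).im = 0 := by
  rw [Phi, ← integral_const_mul]
  refine integral_im_eq_zero fun k => ?_
  simp only [phiIntegrand, symbolD_zero, symbolZero_neg, fourierHat_neg, inner_neg_left,
    PiLp.neg_apply, map_mul, map_div₀, map_add, Complex.conj_I, Complex.conj_ofReal,
    Complex.conj_conj, Complex.ofReal_neg, add_zero]
  ring

lemma integral_phiDerivIntegrand_im (ρ : E3 → ℝ) (v : E3) (Ψ f : E3 → ℝ) (j : Fin 3) :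
    (I * ∫ k, phiDerivIntegrand ρ v Ψ f j k).im = 0 := by
  rw [← integral_const_mul]
  refine integral_im_eq_zero fun k => ?_
  simp only [phiDerivIntegrand, symbolZero_neg, fourierHat_neg, inner_neg_left, norm_neg, neg_sq,
    PiLp.neg_apply, map_mul, map_div₀, map_sub, map_pow, Complex.conj_I, Complex.conj_ofReal,
    Complex.conj_conj, Complex.ofReal_neg, Complex.conj_ofNat]
  ring

lemma integrable_fourierHat_mul_conj {f : E3 → ℝ} (hf : Integrable f) {g : E3 → ℂ}
    (hg : Integrable g) : Integrable fun k => fourierHat f k * conj (g k) :=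
  Integrable.bdd_mul (Complex.conjCLE.toContinuousLinearMap.integrable_comp hg)
    (continuous_fourierHat hf).aestronglyMeasurable
    (Filter.Eventually.of_forall (norm_fourierHat_le f))

lemma integral_sub_integral_invTransform {Ψ f : E3 → ℝ} (hΨ : Integrable Ψ) (hf : Integrable f)
    {a b : E3 → ℂ} (ha : Integrable a) (hb : Integrable b) :
    (∫ x, Ψ x * invTransform b x) - ∫ x, f x * invTransform a x =
      (∫ k, fourierHat Ψ k * conj (b k) - fourierHat f k * conj (a k)).re := by
  rw [integral_mul_invTransform hΨ hb, integral_mul_invTransform hf ha, ← Complex.sub_re,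
    integral_sub (integrable_fourierHat_mul_conj hΨ hb) (integrable_fourierHat_mul_conj hf ha)]

/-! ### The soliton momentum and the matrix `B_v` -/

lemma partialD_solitonP {v : E3} (hv : ‖v‖ < 1) (j : Fin 3) :
    partialD j solitonP v = (Real.sqrt (1 - ‖v‖ ^ 2))⁻¹ • basisVec j +
      (v j * (Real.sqrt (1 - ‖v‖ ^ 2))⁻¹ ^ 3) • v := by
  have hpos : 0 < 1 - ‖v‖ ^ 2 := by nlinarith [norm_nonneg v]
  have hν : 0 < Real.sqrt (1 - ‖v‖ ^ 2) := Real.sqrt_pos.2 hpos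
  apply partialD_eq_of_hasDerivAt
  have hn : ∀ t : ℝ, ‖v + t • basisVec j‖ ^ 2 = ‖v‖ ^ 2 + (2 * v j) * t + t ^ 2 := fun t => by
    rw [norm_add_sq_real, real_inner_smul_right, inner_basisVec, norm_smul, mul_pow]
    simp [basisVec]
    ring
  have h1 : HasDerivAt (fun t : ℝ => 1 - (‖v‖ ^ 2 + (2 * v j) * t + t ^ 2)) (-(2 * v j)) 0 := by
    have h2 := (((hasDerivAt_id (0 : ℝ)).const_mul (2 * v j)).const_add (‖v‖ ^ 2)).fun_add
      ((hasDerivAt_id (0 : ℝ)).fun_pow 2)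
    simpa using h2.const_sub 1
  have h3 := ((h1.sqrt (by simpa using hpos.ne')).fun_inv (by simpa using hν.ne')).fun_smul
    (((hasDerivAt_id (0 : ℝ)).smul_const (basisVec j)).const_add v)
  simp only [solitonP, hn]
  refine h3.congr_deriv ?_
  simp only [mul_zero, add_zero, ne_eq, OfNat.ofNat_ne_zero, not_false_eq_true, zero_pow, id,
    zero_smul, one_smul]
  congr 2
  field_simp

/-- Rank-one inversion: `(v⊗v)² = |v|² v⊗v`, so `I - v⊗v` has inverse `I + (1-|v|²)⁻¹ v⊗v`. -/
lemma matB_inv {v : E3} (hv : ‖v‖ < 1) :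
    (matB v)⁻¹ = (Real.sqrt (1 - ‖v‖ ^ 2))⁻¹ •
      (1 + (1 - ‖v‖ ^ 2)⁻¹ • Matrix.vecMulVec v.ofLp v.ofLp) := by
  have hpos : 0 < 1 - ‖v‖ ^ 2 := by nlinarith [norm_nonneg v]
  have hν : Real.sqrt (1 - ‖v‖ ^ 2) ≠ 0 := (Real.sqrt_pos.2 hpos).ne'
  have hdot : v.ofLp ⬝ᵥ v.ofLp = ‖v‖ ^ 2 := by
    rw [EuclideanSpace.real_norm_sq_eq]
    simp [dotProduct, pow_two]
  apply Matrix.inv_eq_right_inv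
  have hB : matB v = Real.sqrt (1 - ‖v‖ ^ 2) • (1 - Matrix.vecMulVec v.ofLp v.ofLp) := rfl
  rw [hB, Matrix.smul_mul, Matrix.mul_smul, smul_smul, mul_inv_cancel₀ hν, one_smul, sub_mul,
    one_mul, mul_add, mul_one, Matrix.mul_smul, Matrix.vecMulVec_mul_vecMulVec, hdot,
    Matrix.vecMulVec_smul, smul_smul]
  have : Matrix.vecMulVec v.ofLp v.ofLp + ((1 - ‖v‖ ^ 2)⁻¹ * ‖v‖ ^ 2) •
      Matrix.vecMulVec v.ofLp v.ofLp = (1 - ‖v‖ ^ 2)⁻¹ • Matrix.vecMulVec v.ofLp v.ofLp := by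
    nth_rewrite 1 [← one_smul ℝ (Matrix.vecMulVec v.ofLp v.ofLp)]
    rw [← add_smul]
    congr 1
    field_simp
    ring
  rw [this]
  abel

/-- `B_v⁻¹` is the Jacobian of `v ↦ p_v`; this is how the matrix enters the second orthogonality
condition. -/
lemma inner_partialD_solitonP {v : E3} (hv : ‖v‖ < 1) (j : Fin 3) (q : E3) :
    ⟪q, partialD j solitonP v⟫_ℝ = ((matB v)⁻¹ *ᵥ q.ofLp) j := by
  have hpos : 0 < 1 - ‖v‖ ^ 2 := by nlinarith [norm_nonneg v]
  have hν : 0 < Real.sqrt (1 - ‖v‖ ^ 2) := Real.sqrt_pos.2 hpos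
  have hsq := Real.sq_sqrt hpos.le
  have hdot : v.ofLp ⬝ᵥ q.ofLp = ⟪q, v⟫_ℝ := by
    simp [PiLp.inner_apply, dotProduct]
  rw [partialD_solitonP hv, inner_add_right, real_inner_smul_right, real_inner_smul_right,
    inner_basisVec, matB_inv hv, Matrix.smul_mulVec, Matrix.add_mulVec, Matrix.one_mulVec,
    Matrix.smul_mulVec, Matrix.vecMulVec_mulVec, hdot, ← hsq]
  simp only [Pi.smul_apply, Pi.add_apply, smul_eq_mul,
    op_smul_eq_smul, Real.sqrt_sq hν.le]
  field_simp

namespace IsChargeDistribution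

variable {ρ : E3 → ℝ} (hρ : IsChargeDistribution ρ)
include hρ

lemma integrable_coord_mul_psiHat {v : E3} (hv : ‖v‖ < 1) (j : Fin 3) :
    Integrable fun k => I * (k j : ℂ) * psiHat ρ v k :=
  integrable_coord_mul (hρ.measurable_psiHat v)
    (by simpa using hρ.integrable_pow_norm_mul_psiHat hv (n := 1) (by norm_num)) j

lemma integrable_coord_mul_piHat {v : E3} (hv : ‖v‖ < 1) (j : Fin 3) :
    Integrable fun k => I * (k j : ℂ) * piHat ρ v k :=
  integrable_coord_mul (hρ.measurable_piHat v) (hρ.integrable_norm_mul_piHat hv) j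

lemma symplecticConverges_tau {v : E3} (hv : ‖v‖ < 1) {X : State} (hΨ : Integrable X.psi)
    (hf : Integrable X.pi) (j : Fin 3 ⊕ Fin 3) : SymplecticConverges X (tau ρ v j) := by
  rcases j with j | j
  · simp only [SymplecticConverges, tau, hρ.partialD_solitonPsi hv, hρ.partialD_solitonPi hv]
    exact ⟨integrable_mul_invTransform hΨ (hρ.integrable_coord_mul_piHat hv j),
      integrable_mul_invTransform hf (hρ.integrable_coord_mul_psiHat hv j)⟩
  · simp only [SymplecticConverges, tau, hρ.partialD_velocity_solitonPsi hv,
      hρ.partialD_velocity_solitonPi hv]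
    exact ⟨integrable_mul_invTransform hΨ (hρ.integrable_piHatDeriv hv j),
      integrable_mul_invTransform hf (hρ.integrable_psiHatDeriv hv j)⟩

/-- After Parseval the integrands agree pointwise up to sign: conjugating the purely imaginary
factors `ik_j` and `ik·v` accounts for the signs. -/
lemma symplecticForm_tau_inl {v : E3} (hv : ‖v‖ < 1) {X : State} (hΨ : Integrable X.psi)
    (hf : Integrable X.pi) (j : Fin 3) :
    ((symplecticForm X (tau ρ v (Sum.inl j)) : ℝ) : ℂ) =
      -((X.p j : ℂ) + Phi ρ v X.psi X.pi 0 j) := by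
  have hΦ : Phi ρ v X.psi X.pi 0 j = ((Phi ρ v X.psi X.pi 0 j).re : ℂ) :=
    Complex.ext (by simp) (by simp [Phi_zero_im])
  have h1 : (∫ k, fourierHat X.psi k * conj (I * (k j : ℂ) * piHat ρ v k) -
      fourierHat X.pi k * conj (I * (k j : ℂ) * psiHat ρ v k)) = -Phi ρ v X.psi X.pi 0 j := by
    rw [Phi, ← integral_const_mul, ← integral_neg]
    congr 1; ext k
    simp only [phiIntegrand, symbolD_zero, piHat, psiHat, map_mul, map_div₀, map_neg,
      Complex.conj_I, Complex.conj_ofReal, add_zero]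
    ring
  simp only [symplecticForm, tau, hρ.partialD_solitonPsi hv, hρ.partialD_solitonPi hv]
  rw [integral_sub_integral_invTransform hΨ hf (hρ.integrable_coord_mul_psiHat hv j)
    (hρ.integrable_coord_mul_piHat hv j), h1, inner_zero_right, inner_basisVec, hΦ]
  push_cast
  simp
  ring

/-- Conjugation turns `-sρ̂/D` into `s·conj ρ̂/D` at imaginary `s`, and `∂_{v_j} = ik_j ∂_s`. The
field terms therefore combine to `ik_j ∂_s((sΨ̂ + Π̂)/D) conj ρ̂`, the differentiated integrand of
`Φ_j`. -/
lemma symplecticForm_tau_inr {v : E3} (hv : ‖v‖ < 1) {X : State} (hΨ : Integrable X.psi)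
    (hf : Integrable X.pi) (j : Fin 3) :
    ((symplecticForm X (tau ρ v (Sum.inr j)) : ℝ) : ℂ) =
      ((((matB v)⁻¹ *ᵥ X.q.ofLp) j : ℝ) : ℂ) +
        I * ∫ k, phiDerivIntegrand ρ v X.psi X.pi j k := by
  set T := I * ∫ k, phiDerivIntegrand ρ v X.psi X.pi j k with hT
  have hTr : T = (T.re : ℂ) :=
    Complex.ext (by simp) (by rw [Complex.ofReal_im, hT, integral_phiDerivIntegrand_im])
  have h1 : (∫ k, fourierHat X.psi k * conj (piHatDeriv ρ j v k) -
      fourierHat X.pi k * conj (psiHatDeriv ρ j v k)) = T := by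
    rw [hT, ← integral_const_mul]
    refine integral_congr_ae ?_
    filter_upwards [compl_mem_ae_iff.2 (measure_singleton (0 : E3))] with k hk
    have h0 : (symbolZero v k : ℂ) ≠ 0 := Complex.ofReal_ne_zero.2 (symbolZero_pos hv hk).ne'
    simp only [phiDerivIntegrand, piHatDeriv, psiHatDeriv, psiHat, map_mul, map_div₀, map_neg,
      map_add, map_pow, Complex.conj_I, Complex.conj_ofReal, Complex.conj_ofNat]
    field_simp
    rw [symbolZero]
    push_cast
    ring_nf
    simp only [I_sq]
    ring
  simp only [symplecticForm, tau, hρ.partialD_velocity_solitonPsi hv,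
    hρ.partialD_velocity_solitonPi hv]
  rw [integral_sub_integral_invTransform hΨ hf (hρ.integrable_psiHatDeriv hv j)
    (hρ.integrable_piHatDeriv hv j), h1, inner_zero_right, inner_partialD_solitonP hv, hTr]
  push_cast
  simp
  ring

end IsChargeDistribution

end WaveParticle

end

/-! ### The equivalence -/

theorem lemma9p6 (ρ : WaveParticle.E3 → ℝ) (hρ : WaveParticle.IsChargeDistribution ρ)
    (v : WaveParticle.E3) (hv : ‖v‖ < 1)
    (δ : ℝ) (hδ₀ : 0 < δ) (hδ₁ : δ < 1 / 2)
    (X₀ : WaveParticle.State) (hX₀ : WaveParticle.MemPhaseSpace (4 + δ) X₀) :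
    -- all the quantities involved are well defined
    (∀ j, WaveParticle.SymplecticConverges X₀ (WaveParticle.tau ρ v j)) ∧
    (∀ z ∈ WaveParticle.laplaceDomain, ∀ j,
      MeasureTheory.Integrable (WaveParticle.phiIntegrand ρ v X₀.psi X₀.pi z j)) ∧
    DifferentiableWithinAt ℂ (WaveParticle.Phi ρ v X₀.psi X₀.pi)
      WaveParticle.laplaceDomain 0 ∧
    -- the equivalence
    ((∀ j, WaveParticle.symplecticForm X₀ (WaveParticle.tau ρ v j) = 0) ↔
      (∀ j, (X₀.p j : ℂ) + WaveParticle.Phi ρ v X₀.psi X₀.pi 0 j = 0) ∧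
      (∀ j, ((((WaveParticle.matB v)⁻¹ *ᵥ X₀.q.ofLp) j : ℝ) : ℂ) +
        WaveParticle.PhiDerivZero ρ v X₀.psi X₀.pi j = 0)) := by

  obtain ⟨⟨hΨw, hΨd⟩, hpiw⟩ := hX₀
  choose g hg hgw using hΨd
  have hΨi := hΨw.integrable (by linarith)
  have hpii := hpiw.integrable (by linarith)
  have hgi := fun j => (hgw j).integrable (by linarith)
  -- The exponent `2 + δ/2` exceeds `2`, as the decay in time requires, and satisfies `2 + δ/2 + 3/2
  -- < 4 + δ`, as Cauchy–Schwarz requires.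
  have hgq := fun j => (hgw j).integrable_rpow_mul (q := 2 + δ / 2) (by linarith)
  have hpiq := hpiw.integrable_rpow_mul (q := 2 + δ / 2) (by linarith)
  have hgF := fun j => (hg j).fourierHat_eq hΨi (hgi j)
  have hder : HasDerivWithinAt (WaveParticle.Phi ρ v X₀.psi X₀.pi)
      (fun j => I * ∫ k, WaveParticle.phiDerivIntegrand ρ v X₀.psi X₀.pi j k)
      WaveParticle.laplaceDomain 0 :=
    hasDerivWithinAt_pi.2 fun j => hρ.hasDerivWithinAt_Phi_apply hv (by linarith) hΨi (hgi j) hpii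
      (hgq j) hpiq (hgF j)
  refine ⟨hρ.symplecticConverges_tau hv hΨi hpii, ?_, hder.differentiableWithinAt, ?_⟩
  · rintro z (rfl | hz) j
    · exact hρ.integrable_phiIntegrand_zero hv hΨi hpii j
    · exact hρ.integrable_phiIntegrand_of_re_pos v (hgi j) hpii (hgF j) hz
  · rw [WaveParticle.PhiDerivZero,
      hder.derivWithin WaveParticle.uniqueDiffWithinAt_laplaceDomain, Sum.forall]
    refine and_congr (forall_congr' fun j => ?_) (forall_congr' fun j => ?_)
    · rw [← Complex.ofReal_eq_zero, hρ.symplecticForm_tau_inl hv hΨi hpii, neg_eq_zero]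
    · rw [← Complex.ofReal_eq_zero, hρ.symplecticForm_tau_inr hv hΨi hpii]
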